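/- **Setting.** Consider a system of $n\ge 1$ spins, labelled by a finite set $V$ with $|V|=n$, each with Hilbert space $\mathbb C^q$, and let $\mathsf d$ be a distance on $V$. Assume that there are $d\ge 1$, $A>0$ and $r_0>0$ such that $|\{x\in V:\mathsf d(v,x)\le r\}|\le A\,r^d$ for all $v\in V$ and all $r\ge r_0$. Let $k\ge1$ be an integer. *Correlation length.* A state $\sigma$ has correlation length $\xi>0$ with constant $C>0$ if, for any two disjoint nonempty regions $\Lambda_1,\Lambda_2\subset V$ and any observables $h_1,h_2$ acting on $\Lambda_1$ and $\Lambda_2$ respectively, $$\big|\operatorname{Tr}[\sigma h_1h_2]-\operatorname{Tr}[\sigma h_1]\operatorname{Tr}[\sigma h_2]\big|\le C\,\|h_1\|\,\|h_2\|\,e^{-\mathsf d(\Lambda_1,\Lambda_2)/\xi},\qquad \mathsf d(\Lambda_1,\Lambda_2)=\min_{x_i\in\Lambda_i}\mathsf d(x_1,x_2).$$ *$k$-local $W_1$ distance.* An operator is $k$-local if it is a sum of operators each acting on at most $k$ spins. For a self-adjoint $k$-local $H$ let $$\|H\|_{\rm loc}=2\min\Big\{\max_{x\in V}\sum_{\Lambda\ni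 x}\|h_\Lambda\| : H=\sum_{\Lambda\subseteq V,\,|\Lambda|\le k}h_\Lambda,\ h_\Lambda \text{ an observable acting on }\Lambda\Big\},$$ and $\|\rho-\sigma\|_{k\text{-}W_1\rm loc}=\max\{\operatorname{Tr}[(\rho-\sigma)H]: H=H^\dagger\ k\text{-local},\ \|H\|_{\rm loc}\le1\}$. *Measured relative entropy.* $S_M(\rho\|\sigma)=\sup\sum_a \operatorname{Tr}[E_a\rho]\log\frac{\operatorname{Tr}[E_a\rho]}{\operatorname{Tr}[E_a\sigma]}\in[0,\infty]$, the supremum being over all finite POVMs $\{E_a\}$ (with $0\log\frac0b=0$ and $a\log\frac a0=\infty$ for $a>0$). *The function $f$.* For real $x$ let $F(x)=\max_{s\ge0}s\,(x-e^s+1+\tfrac s2)$, let $s^*(x)$ be the unique maximizer, and for $w\ge 0$ let $$b(w)=\frac{\xi}{kA^2}\big(k\,s^*(kw)+F(kw)\big),\qquad f(w)=\frac{F(kw)}{k^2A^2\,b(w)^{\frac{2d}{2d+1}}},\qquad f(0)=0 .$$ **Theorem.** The function $f$ is strictly increasing on $[0,\infty)$. Let $\sigma$ be a state with correlation length $\xi$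 and constant $C$, let $\rho$ be any state, and let $w=\frac1n\|\rho-\sigma\|_{k\text{-}W_1\rm loc}$. If $n$ is large enough that $n\,b(w)\ge r_0^{2d+1}$, then $$S_M(\rho\|\sigma)\ \ge\ n^{\frac1{2d+1}}f(w)-\log(C+1).$$ Without this condition on $n$ and $w$ one still has $$S_M(\rho\|\sigma)\ \ge\ n^{\frac1{2d+1}}f(w)-\max\Big\{\log(C+1),\frac{r_0}{k\,\xi}\Big\}.$$ -/

import Mathlib

noncomputable section

namespace SpinLattice

section Operators

variable {V : Type*} [Fintype V] [DecidableEq V] {q : ℕ}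

/-- Operators on the Hilbert space `(ℂ^q)^{⊗ V}` of a system of spins labelled by `V`,
as matrices in the product basis, whose elements are the maps `V → Fin q`. -/
abbrev Op (V : Type*) (q : ℕ) := Matrix (V → Fin q) (V → Fin q) ℂ

open scoped Matrix.Norms.L2Operator in
/-- The operator norm with respect to the Hermitian norm of the Hilbert space. -/
def opNorm (X : Op V q) : ℝ := ‖X‖

open scoped ComplexOrder in
/-- Density matrices on a finite-dimensional Hilbert space. -/
def IsState {ι : Type*} [Fintype ι] (ρ : Matrix ι ι ℂ) : Prop :=
  ρ.PosSemidef ∧ ρ.trace = 1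

/-- The expectation value of `X` in the state `ω`. -/
def expect (ω X : Op V q) : ℂ := (ω * X).trace

/-- The operator `h ⊗ I`, where `h` acts on the spins in `Λ` and `I` is the identity on the
other spins. -/
def embed (Λ : Finset V) (h : Op Λ q) : Op V q :=
  Matrix.of fun x y =>
    if ∀ v, v ∉ Λ → x v = y v then h (fun v => x v) (fun v => y v) else 0

/-- `X` acts only on the spins in `Λ`. -/
def ActsOn (Λ : Finset V) (X : Op V q) : Prop := ∃ h : Op Λ q, X = embed Λ h

/-- The observables (self-adjoint operators) of the region `Λ`. -/
def IsObservableOn (Λ : Finset V) (X : Op V q) : Prop := X.IsHermitian ∧ ActsOn Λ X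

/-- `X` is a sum of operators each acting on at most `k` spins. -/
def IsKLocal (k : ℕ) (X : Op V q) : Prop :=
  ∃ Y : Finset V → Op V q,
    (∀ Λ, ActsOn Λ (Y Λ)) ∧ (∀ Λ, k < Λ.card → Y Λ = 0) ∧ X = ∑ Λ, Y Λ

/-- `h` is a decomposition `H = ∑ h_Λ` of `H` into observables `h_Λ` of regions `Λ` that
contain at most `k` spins. -/
def IsDecomposition (k : ℕ) (H : Op V q) (h : Finset V → Op V q) : Prop :=
  (∀ Λ, IsObservableOn Λ (h Λ)) ∧ (∀ Λ, k < Λ.card → h Λ = 0) ∧ H = ∑ Λ, h Λ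

/-- The local norm of a `k`-local observable: twice the minimum over the decompositions
`H = ∑ h_Λ` of the maximum over the spins `x` of `∑_{Λ ∋ x} ‖h_Λ‖`. -/
def localNorm (k : ℕ) (H : Op V q) : ℝ :=
  2 * sInf {c : ℝ | ∃ h : Finset V → Op V q, IsDecomposition k H h ∧
    c = ⨆ x : V, ∑ Λ ∈ Finset.univ.filter (fun Λ : Finset V => x ∈ Λ), opNorm (h Λ)}

/-- The `k`-local quantum `W₁` norm of a traceless self-adjoint operator: the dual of the
local norm on the `k`-local observables. -/
def localW1Norm (k : ℕ) (Δ : Op V q) : ℝ :=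
  sSup {c : ℝ | ∃ H : Op V q, H.IsHermitian ∧ IsKLocal k H ∧ localNorm k H ≤ 1 ∧
    c = (Δ * H).trace.re}

/-- The distance between two (nonempty) regions. -/
def regionDist [MetricSpace V] (Λ₁ Λ₂ : Finset V) : ℝ :=
  ⨅ p : Λ₁ × Λ₂, dist (p.1 : V) (p.2 : V)

/-- `ω` has correlation length `ξ` with constant `C`. -/
def HasCorrelationLength [MetricSpace V] (ω : Op V q) (ξ C : ℝ) : Prop :=
  ∀ Λ₁ Λ₂ : Finset V, Λ₁.Nonempty → Λ₂.Nonempty → Disjoint Λ₁ Λ₂ →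
    ∀ X₁ X₂ : Op V q, IsObservableOn Λ₁ X₁ → IsObservableOn Λ₂ X₂ →
      ‖expect ω (X₁ * X₂) - expect ω X₁ * expect ω X₂‖ ≤
        C * (opNorm X₁ * opNorm X₂) * Real.exp (-(regionDist Λ₁ Λ₂ / ξ))

end Operators

section Entropy

variable {ι : Type*} [Fintype ι] [DecidableEq ι]

open scoped ComplexOrder in
/-- A positive operator-valued measure with `m` outcomes. -/
def IsPOVM {m : ℕ} (E : Fin m → Matrix ι ι ℂ) : Prop :=
  (∀ a, (E a).PosSemidef) ∧ ∑ a, E a = 1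

/-- The summand `a log (a / b)` of the Kullback-Leibler divergence, for `a, b ≥ 0`,
with `0 log (0 / b) = 0` and `a log (a / 0) = ∞` for `a > 0`. -/
def klTerm (a b : ℝ) : EReal :=
  if a = 0 then 0 else if b = 0 then ⊤ else ((a * Real.log (a / b) : ℝ) : EReal)

/-- The measured relative entropy, with values in the extended reals: the supremum over all
POVMs of the Kullback-Leibler divergence between the distributions of the outcomes. -/
def measuredRelEntropy (ρ σ : Matrix ι ι ℂ) : EReal :=
  sSup {S : EReal | ∃ (m : ℕ) (E : Fin m → Matrix ι ι ℂ), IsPOVM E ∧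
    S = ∑ a, klTerm ((E a * ρ).trace.re) ((E a * σ).trace.re)}

end Entropy

section RateFunction

/-- The function `s ↦ s (x - e^s + 1 + s / 2)`. -/
def rateObj (x s : ℝ) : ℝ := s * (x - Real.exp s + 1 + s / 2)

theorem hasDerivAt_rateObj (x s : ℝ) :
    HasDerivAt (rateObj x) (x - (Real.exp s - 1) * (s + 1)) s := by
  have h := (hasDerivAt_id s).mul
    ((((Real.hasDerivAt_exp s).const_sub x).add_const 1).add ((hasDerivAt_id s).div_const 2))
  refine (h.congr_deriv ?_)
  simp
  ring

theorem strictConcaveOn_rateObj (x : ℝ) : StrictConcaveOn ℝ (Set.Ici 0) (rateObj x) := by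
  refine StrictAntiOn.strictConcaveOn_of_deriv (convex_Ici 0)
    (fun s _ => (hasDerivAt_rateObj x s).continuousAt.continuousWithinAt) ?_
  intro a ha b _ hab
  rw [interior_Ici, Set.mem_Ioi] at ha
  rw [(hasDerivAt_rateObj x a).deriv, (hasDerivAt_rateObj x b).deriv]
  have h1 : Real.exp a < Real.exp b := Real.exp_lt_exp.2 hab
  have h2 : 1 < Real.exp a := Real.one_lt_exp_iff.2 ha
  nlinarith

/-- `s ↦ s (x - e^s + 1 + s / 2)` has exactly one maximizer on `[0, ∞)`. -/
theorem existsUnique_rateObj_max (x : ℝ) :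
    ∃! s : ℝ, 0 ≤ s ∧ ∀ t : ℝ, 0 ≤ t → rateObj x t ≤ rateObj x s := by
  have hcont : Continuous (rateObj x) :=
    continuous_iff_continuousAt.2 fun s => (hasDerivAt_rateObj x s).continuousAt
  have hM : (0 : ℝ) ≤ max (2 * x) 0 := le_max_right _ _
  obtain ⟨s, hs, hmax⟩ := isCompact_Icc.exists_isMaxOn
    (Set.nonempty_Icc.2 hM) hcont.continuousOn
  have hmax' : ∀ t : ℝ, 0 ≤ t → rateObj x t ≤ rateObj x s := by
    intro t ht
    by_cases htM : t ≤ max (2 * x) 0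
    · exact hmax ⟨ht, htM⟩
    · have h0 : rateObj x 0 ≤ rateObj x s := hmax ⟨le_rfl, hM⟩
      have h2x : 2 * x ≤ t := (le_max_left _ _).trans (not_le.1 htM).le
      have hexp := Real.add_one_le_exp t
      have h1 : rateObj x t ≤ 0 := by
        unfold rateObj
        exact mul_nonpos_of_nonneg_of_nonpos ht (by linarith)
      have h00 : rateObj x 0 = 0 := by simp [rateObj]
      linarith
  refine ⟨s, ⟨hs.1, hmax'⟩, ?_⟩
  rintro t ⟨ht, htmax⟩
  exact (strictConcaveOn_rateObj x).eq_of_isMaxOn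
    (fun u hu => htmax u hu) (fun u hu => hmax' u hu) ht hs.1

/-- `s*(x)`, the maximizer of `s (x - e^s + 1 + s / 2)` over `s ≥ 0`. -/
def sStar (x : ℝ) : ℝ := (existsUnique_rateObj_max x).choose

/-- `F(x)`, the maximum of `s (x - e^s + 1 + s / 2)` over `s ≥ 0`. -/
def rateF (x : ℝ) : ℝ := sSup (rateObj x '' Set.Ici 0)

theorem sStar_spec (x : ℝ) :
    0 ≤ sStar x ∧ ∀ t : ℝ, 0 ≤ t → rateObj x t ≤ rateObj x (sStar x) :=
  (existsUnique_rateObj_max x).choose_spec.1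

theorem rateF_eq (x : ℝ) : rateF x = rateObj x (sStar x) := by
  refine IsGreatest.csSup_eq ⟨⟨sStar x, (sStar_spec x).1, rfl⟩, ?_⟩
  rintro _ ⟨t, ht, rfl⟩
  exact (sStar_spec x).2 t ht

/-- The quantity `(ξ / (k A²)) (k s*(k w) + F(k w))`. -/
def bracket (k : ℕ) (A ξ w : ℝ) : ℝ :=
  ξ / (k * A ^ 2) * (k * sStar (k * w) + rateF (k * w))

/-- The function `f` of the transportation-cost inequality. -/
def costF (k : ℕ) (d A ξ w : ℝ) : ℝ :=
  rateF (k * w) / ((k : ℝ) ^ 2 * A ^ 2 * bracket k A ξ w ^ (2 * d / (2 * d + 1)))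

end RateFunction

end SpinLattice

end

namespace SpinLattice

open Matrix
open scoped MatrixOrder Matrix.Norms.L2Operator ComplexOrder

/-! ### Algebra of operators supported on regions. -/

section Algebra

variable {V : Type*} [Fintype V] [DecidableEq V] {q : ℕ}

/-! Measuring an observable `G` in an eigenbasis gives `S_M(ρ‖σ) ≥ t Tr(ρG) - log Tr(σ exp(tG))`
(`le_measuredRelEntropy`), so the task is to bound the moment generating function of `σ`. Take `H`
almost optimal for the `W₁` norm, decompose it and subtract from each term its expectation in `σ`:
the centred terms `g_Λ` satisfy `∑_{Λ ∋ x} ‖g_Λ‖ ≤ 1`, and `G` is their sum.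

Fix a radius `r` and expand `Tr(σ G^m)` over `m`-tuples of regions. If some region is further than
`r` from all the others, its centred factor commutes with the rest, and correlation decay gives `C
e^{-r/ξ}` times the product of the norms (`norm_expect_list_prod_le`); in total this costs at most
`C exp(tn - r/ξ)`. In the remaining tuples the nearness graph has no isolated vertex. Stars can be
peeled off such a graph one at a time (`exists_star`), which yields a recursive inequality for the
total weight (`clusterSum_succ_le`). By a Grönwall argument its generating function is at most
`exp((T/κ²) mgfExponent(κt))` (`sum_le_exp_mgfExponent`), with `K = A r^d` bounding the balls, `κ =
kK` and `T = nK`.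

Put `t = s/(kK²)`. By `mul_mgfExponent_le` the exponent is at most `n/(kK)² · mgfExponent s`, and
the best `s` leaves `n F(kw)/(kK)²`. The radius `r = (n b(w))^{1/(2d+1)}` keeps the far tuples below
`C`, which costs `log(C+1)`, and turns the main term into `n^{1/(2d+1)} f(w)`. If this radius is
below `r₀` the ball estimate is not available, but then the main term is at most `r₀/(kξ)`
(`rpow_mul_costF_le`) and nonnegativity of `S_M` suffices. -/

theorem embed_apply (Λ : Finset V) (h : Op Λ q) (x y : V → Fin q) :
    embed Λ h x y =
      if ∀ v, v ∉ Λ → x v = y v then h (fun v => x v) (fun v => y v) else 0 := rfl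

theorem embed_mul (Λ : Finset V) (h h' : Op Λ q) :
    embed Λ h * embed Λ h' = embed Λ (h * h') := by
  ext x y
  rw [Matrix.mul_apply, embed_apply]
  split_ifs with hxy
  · rw [Matrix.mul_apply]
    symm
    -- Only intermediate configurations that agree with `y` outside `Λ` contribute; their
    -- restrictions to `Λ` parametrize them.
    refine Finset.sum_of_injOn (fun c v => if hv : v ∈ Λ then c ⟨v, hv⟩ else y v) ?_
      (fun _ _ => Finset.mem_coe.2 (Finset.mem_univ _)) ?_ ?_
    · intro c _ c' _ hcc
      ext ⟨v, hv⟩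
      have := congrFun hcc v
      simp only [hv, dif_pos] at this
      rw [this]
    · intro z _ hz
      rw [embed_apply Λ h', if_neg, mul_zero]
      intro hh
      refine hz ⟨fun v => z v, by simp, funext fun v => ?_⟩
      by_cases hv : v ∈ Λ
      · simp [hv]
      · simp [hv, hh v hv]
    · intro c _
      rw [embed_apply, embed_apply, if_pos, if_pos]
      · congr 2 <;> ext v <;> simp
      · intro v hv; simp [hv]
      · intro v hv; simp [hv, hxy]
  · refine Finset.sum_eq_zero fun z _ => ?_
    rw [embed_apply, embed_apply]
    split_ifs with h1 h2
    · exact absurd (fun v hv => (h1 v hv).trans (h2 v hv)) hxy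
    all_goals simp

theorem ActsOn.mul {Λ : Finset V} {X Y : Op V q} (hX : ActsOn Λ X) (hY : ActsOn Λ Y) :
    ActsOn Λ (X * Y) := by
  obtain ⟨h, rfl⟩ := hX
  obtain ⟨h', rfl⟩ := hY
  exact ⟨h * h', embed_mul Λ h h'⟩

theorem ActsOn.add {Λ : Finset V} {X Y : Op V q} (hX : ActsOn Λ X) (hY : ActsOn Λ Y) :
    ActsOn Λ (X + Y) := by
  obtain ⟨h, rfl⟩ := hX
  obtain ⟨h', rfl⟩ := hY
  refine ⟨h + h', ?_⟩
  ext x y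
  simp only [embed_apply, Matrix.add_apply]
  split_ifs <;> simp

theorem ActsOn.smul {Λ : Finset V} {X : Op V q} (c : ℂ) (hX : ActsOn Λ X) :
    ActsOn Λ (c • X) := by
  obtain ⟨h, rfl⟩ := hX
  refine ⟨c • h, ?_⟩
  ext x y
  simp only [embed_apply, Matrix.smul_apply]
  split_ifs <;> simp

theorem ActsOn.conjTranspose {Λ : Finset V} {X : Op V q} (hX : ActsOn Λ X) :
    ActsOn Λ Xᴴ := by
  obtain ⟨h, rfl⟩ := hX
  refine ⟨hᴴ, ?_⟩
  ext x y
  simp only [embed_apply, Matrix.conjTranspose_apply]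
  simp only [eq_comm (a := x _)]
  split_ifs <;> simp

theorem actsOn_one (Λ : Finset V) : ActsOn Λ (1 : Op V q) := by
  refine ⟨1, ?_⟩
  ext x y
  simp only [embed_apply, Matrix.one_apply]
  by_cases hxy : x = y
  · subst hxy; simp
  · rw [if_neg hxy]
    split_ifs with h1 h2
    · refine absurd (funext fun v => ?_) hxy
      by_cases hv : v ∈ Λ
      · exact congrFun h2 ⟨v, hv⟩
      · exact h1 v hv
    all_goals rfl

theorem actsOn_zero (Λ : Finset V) : ActsOn Λ (0 : Op V q) := by
  simpa using (actsOn_one Λ).smul (0 : ℂ)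

theorem ActsOn.mono {Λ U : Finset V} (hΛU : Λ ⊆ U) {X : Op V q} (hX : ActsOn Λ X) :
    ActsOn U X := by
  obtain ⟨h, rfl⟩ := hX
  refine ⟨Matrix.of fun a b => if ∀ v : U, (v : V) ∉ Λ → a v = b v then
    h (fun v => a ⟨v, hΛU v.2⟩) (fun v => b ⟨v, hΛU v.2⟩) else 0, ?_⟩
  ext x y
  simp only [embed_apply, Matrix.of_apply]
  by_cases hxy : ∀ v, v ∉ Λ → x v = y v
  · rw [if_pos hxy, if_pos (fun v hv => hxy v (fun h => hv (hΛU h))), if_pos]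
    exact fun v hv => hxy v hv
  · rw [if_neg hxy]
    split_ifs with h1 h2
    · refine absurd (fun v hv => ?_) hxy
      by_cases hvU : v ∈ U
      · exact h2 ⟨v, hvU⟩ hv
      · exact h1 v hvU
    all_goals rfl

theorem ActsOn.list_prod {Λ : Finset V} {l : List (Op V q)} (hl : ∀ X ∈ l, ActsOn Λ X) :
    ActsOn Λ l.prod := by
  induction l with
  | nil => exact actsOn_one Λ
  | cons X l ih =>
    rw [List.prod_cons]
    exact (hl X (by simp)).mul (ih fun Y hY => hl Y (by simp [hY]))

/-- Serves two degenerate cases: the term of the empty region, which centring annihilates, and a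
product with no factor besides the isolated one. -/
theorem ActsOn.eq_smul_one {X : Op V q} (hX : ActsOn ∅ X) : ∃ c : ℂ, X = c • 1 := by
  obtain ⟨h, rfl⟩ := hX
  refine ⟨h (fun v => absurd v.2 (Finset.notMem_empty _)) (fun v => absurd v.2 (Finset.notMem_empty _)), ?_⟩
  ext x y
  have h0 : ∀ f g : (↥(∅ : Finset V) → Fin q), f = g := fun f g =>
    funext fun v => absurd v.2 (Finset.notMem_empty _)
  simp only [embed_apply, Matrix.smul_apply, Matrix.one_apply]
  by_cases hxy : x = y
  · subst hxy
    simp only [implies_true, if_true, smul_eq_mul, mul_one]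
    congr 1 <;> apply h0
  · rw [if_neg, if_neg hxy, smul_zero]
    exact fun hh => hxy (funext fun v => hh v (by simp))

/-- A single intermediate configuration survives in the matrix product: `y` on `Λ₁` and `x`
elsewhere. The resulting formula is symmetric in the two regions, hence `ActsOn.commute`. -/
theorem embed_mul_embed_apply {Λ₁ Λ₂ : Finset V} (hd : Disjoint Λ₁ Λ₂) (h₁ : Op Λ₁ q)
    (h₂ : Op Λ₂ q) (x y : V → Fin q) :
    (embed Λ₁ h₁ * embed Λ₂ h₂) x y =
      if ∀ v, v ∉ Λ₁ → v ∉ Λ₂ → x v = y v then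
        h₁ (fun v => x v) (fun v => y v) * h₂ (fun v => x v) (fun v => y v) else 0 := by
  have hd' : ∀ v, v ∈ Λ₂ → v ∉ Λ₁ := fun v h2 h1 => Finset.disjoint_left.1 hd h1 h2
  rw [Matrix.mul_apply, Finset.sum_eq_single (fun v => if v ∈ Λ₁ then y v else x v)]
  · rw [embed_apply, embed_apply, if_pos (fun v hv => by simp [hv])]
    by_cases hxy : ∀ v, v ∉ Λ₁ → v ∉ Λ₂ → x v = y v
    · rw [if_pos hxy, if_pos]
      · congr 2 <;> ext v
        · simp
        · simp [hd' v v.2]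
      · intro v hv
        by_cases hv1 : v ∈ Λ₁
        · simp [hv1]
        · simp [hv1, hxy v hv1 hv]
    · rw [if_neg hxy, if_neg, mul_zero]
      intro hh
      refine hxy fun v h1 h2 => ?_
      simpa [h1] using hh v h2
  · intro z _ hz
    rw [embed_apply, embed_apply]
    split_ifs with h1 h2
    · refine absurd (funext fun v => ?_) hz
      by_cases hv : v ∈ Λ₁
      · rw [if_pos hv]; exact h2 v (fun h => hd' v h hv)
      · rw [if_neg hv]; exact (h1 v hv).symm
    all_goals simp
  · simp

theorem ActsOn.commute {Λ₁ Λ₂ : Finset V} (hd : Disjoint Λ₁ Λ₂) {X Y : Op V q}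
    (hX : ActsOn Λ₁ X) (hY : ActsOn Λ₂ Y) : X * Y = Y * X := by
  obtain ⟨h, rfl⟩ := hX
  obtain ⟨h', rfl⟩ := hY
  ext x y
  rw [embed_mul_embed_apply hd, embed_mul_embed_apply hd.symm, mul_comm]
  simp only [forall_comm (α := _ ∉ Λ₁)]

end Algebra

/-! ### States, positivity and expectation values. -/

section States

variable {ι : Type*} [Fintype ι] [DecidableEq ι]

theorem trace_mul_posSemidef_nonneg {ρ E : Matrix ι ι ℂ} (hρ : ρ.PosSemidef)
    (hE : E.PosSemidef) : 0 ≤ (E * ρ).trace.re := by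
  obtain ⟨B, rfl⟩ := CStarAlgebra.nonneg_iff_eq_star_mul_self.1 (Matrix.nonneg_iff_posSemidef.2 hE)
  rw [Matrix.mul_assoc, Matrix.trace_mul_comm, Matrix.mul_assoc]
  have h := (hρ.mul_mul_conjTranspose_same B).trace_nonneg
  rw [Complex.le_def] at h
  simpa [Matrix.mul_assoc, Matrix.star_eq_conjTranspose] using h.1

theorem norm_smul_one_sub_posSemidef {X : Matrix ι ι ℂ} (hX : X.IsHermitian) :
    (((‖X‖ : ℝ) : ℂ) • (1 : Matrix ι ι ℂ) - X).PosSemidef := by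
  have h := IsSelfAdjoint.le_algebraMap_norm_self (a := X) hX
  rw [Matrix.le_iff, Algebra.algebraMap_eq_smul_one] at h
  have e : ((‖X‖ : ℝ) : ℂ) • (1 : Matrix ι ι ℂ) = ‖X‖ • (1 : Matrix ι ι ℂ) := by
    ext i j; simp
  rw [e]
  exact h

theorem IsState.re_trace_mul_le {σ X : Matrix ι ι ℂ} (hσ : IsState σ) (hX : X.IsHermitian) :
    (σ * X).trace.re ≤ ‖X‖ := by
  have h := trace_mul_posSemidef_nonneg hσ.1 (norm_smul_one_sub_posSemidef hX)
  rw [Matrix.sub_mul, Matrix.trace_sub, Matrix.trace_mul_comm X] at h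
  simp [hσ.2] at h
  exact h

/-- The Hermitian part of an operator. -/
noncomputable def hermPart (X : Matrix ι ι ℂ) : Matrix ι ι ℂ := (1 / 2 : ℂ) • (X + Xᴴ)

omit [Fintype ι] [DecidableEq ι] in
theorem hermPart_isHermitian (X : Matrix ι ι ℂ) : (hermPart X).IsHermitian := by
  unfold hermPart
  rw [Matrix.IsHermitian, Matrix.conjTranspose_smul, Matrix.conjTranspose_add,
    Matrix.conjTranspose_conjTranspose, add_comm]
  simp

theorem norm_hermPart_le (X : Matrix ι ι ℂ) : ‖hermPart X‖ ≤ ‖X‖ := by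
  unfold hermPart
  rw [norm_smul]
  have h := norm_add_le X Xᴴ
  rw [Matrix.l2_opNorm_conjTranspose] at h
  norm_num
  linarith

theorem exists_unit_mul_eq_norm (z : ℂ) : ∃ c : ℂ, ‖c‖ = 1 ∧ c * z = (‖z‖ : ℂ) := by
  by_cases hz : z = 0
  · exact ⟨1, by simp, by simp [hz]⟩
  · have hz' : (‖z‖ : ℂ) ≠ 0 := by simpa using hz
    refine ⟨(starRingEnd ℂ) z / ‖z‖, by simp [hz], ?_⟩
    rw [div_mul_eq_mul_div, mul_comm, Complex.mul_conj, Complex.normSq_eq_norm_sq]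
    field_simp
    push_cast
    ring

omit [DecidableEq ι] in
/-- If `X` commutes with the Hermitian `Y`, the linear functional `X ↦ Tr (σ X Y)` takes its
absolute value at the Hermitian part of a multiple of `X` by a phase. -/
theorem exists_hermPart_trace_eq {σ X Y : Matrix ι ι ℂ} (hσ : σ.IsHermitian)
    (hY : Y.IsHermitian) (hXY : X * Y = Y * X) :
    ∃ c : ℂ, ‖c‖ = 1 ∧ (σ * (hermPart (c • X) * Y)).trace = (‖(σ * (X * Y)).trace‖ : ℂ) := by
  obtain ⟨c, hc, hcz⟩ := exists_unit_mul_eq_norm (σ * (X * Y)).trace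
  refine ⟨c, hc, ?_⟩
  have h1 : (σ * ((c • X) * Y)).trace = (‖(σ * (X * Y)).trace‖ : ℂ) := by
    rw [← hcz, Matrix.smul_mul, Matrix.mul_smul, Matrix.trace_smul, smul_eq_mul]
  -- Since `X` and `Y` commute, conjugating the trace replaces `c • X` by its adjoint; the phase has
  -- made the trace real, so both halves of the Hermitian part contribute equally.
  have h2 : (σ * ((c • X)ᴴ * Y)).trace = (‖(σ * (X * Y)).trace‖ : ℂ) := by
    have h3 : ((c • X) * Y)ᴴ = (c • X)ᴴ * Y := by
      rw [Matrix.smul_mul, hXY, Matrix.conjTranspose_smul, Matrix.conjTranspose_mul, hY.eq,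
        Matrix.conjTranspose_smul, Matrix.smul_mul]
    have h4 := congrArg star h1
    rw [← Matrix.trace_conjTranspose, Matrix.conjTranspose_mul, h3, hσ.eq,
      Matrix.trace_mul_comm] at h4
    rw [h4]
    simp
  unfold hermPart
  rw [Matrix.smul_mul, Matrix.add_mul, Matrix.mul_smul, Matrix.mul_add, Matrix.trace_smul,
    Matrix.trace_add, h1, h2, smul_eq_mul]
  ring

theorem IsState.norm_trace_mul_le {σ : Matrix ι ι ℂ} (hσ : IsState σ) (X : Matrix ι ι ℂ) :
    ‖(σ * X).trace‖ ≤ ‖X‖ := by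
  obtain ⟨c, hc, h⟩ := exists_hermPart_trace_eq (X := X) hσ.1.1 Matrix.isHermitian_one
    (by simp)
  rw [Matrix.mul_one, Matrix.mul_one] at h
  have h1 := hσ.re_trace_mul_le (hermPart_isHermitian (c • X))
  rw [h, Complex.ofReal_re] at h1
  refine h1.trans ((norm_hermPart_le _).trans ?_)
  rw [norm_smul, hc, one_mul]

end States

/-! ### Decay of correlations for general operators. -/

section Correlations

variable {V : Type*} [Fintype V] [DecidableEq V] {q : ℕ}

theorem IsState.norm_expect_le {σ : Op V q} (hσ : IsState σ) (X : Op V q) :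
    ‖expect σ X‖ ≤ opNorm X := hσ.norm_trace_mul_le X

theorem IsState.expect_eq_re {σ X : Op V q} (hσ : IsState σ) (hX : X.IsHermitian) :
    expect σ X = ((expect σ X).re : ℂ) := by
  have h : star (expect σ X) = expect σ X := by
    unfold expect
    rw [← Matrix.trace_conjTranspose, Matrix.conjTranspose_mul, hσ.1.1.eq, hX.eq,
      Matrix.trace_mul_comm]
  exact (Complex.conj_eq_iff_re.1 h).symm

omit [Fintype V] [DecidableEq V] in
theorem regionDist_ge [MetricSpace V] {Λ₁ Λ₂ : Finset V} (h₁ : Λ₁.Nonempty)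
    (h₂ : Λ₂.Nonempty) {r : ℝ} (h : ∀ x ∈ Λ₁, ∀ y ∈ Λ₂, r ≤ dist x y) :
    r ≤ regionDist Λ₁ Λ₂ := by
  have : Nonempty (Λ₁ × Λ₂) := ⟨⟨⟨_, h₁.choose_spec⟩, ⟨_, h₂.choose_spec⟩⟩⟩
  exact le_ciInf fun p => h _ p.1.2 _ p.2.2

/-- Correlations of a centred observable with an arbitrary operator of a far region. -/
theorem HasCorrelationLength.norm_expect_mul_le [MetricSpace V] {σ : Op V q} {ξ C r : ℝ}
    (hσ : IsState σ) (hcor : HasCorrelationLength σ ξ C) (hξ : 0 < ξ) (hC : 0 < C) (hr : 0 < r)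
    {Λ₁ Λ₂ : Finset V} (h₁ : Λ₁.Nonempty) (h₂ : Λ₂.Nonempty)
    (hdist : ∀ x ∈ Λ₁, ∀ y ∈ Λ₂, r ≤ dist x y) {X Y : Op V q} (hX : ActsOn Λ₁ X)
    (hY : IsObservableOn Λ₂ Y) (hY0 : expect σ Y = 0) :
    ‖expect σ (X * Y)‖ ≤ C * (opNorm X * opNorm Y) * Real.exp (-(r / ξ)) := by
  have hdisj : Disjoint Λ₁ Λ₂ := by
    refine Finset.disjoint_left.2 fun x hx1 hx2 => ?_
    have := hdist x hx1 x hx2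
    rw [dist_self] at this
    linarith
  -- Decay is assumed for observables only, whereas `X` will be a product of observables and need
  -- not be self-adjoint.
  obtain ⟨c, hc, h⟩ := exists_hermPart_trace_eq hσ.1.1 hY.1 (hX.commute hdisj hY.2)
  have hZ : IsObservableOn Λ₁ (hermPart (c • X)) :=
    ⟨hermPart_isHermitian _, ((hX.smul c).add (hX.smul c).conjTranspose).smul _⟩
  have h1 := hcor Λ₁ Λ₂ h₁ h₂ hdisj _ _ hZ hY
  rw [hY0, mul_zero, sub_zero, expect, h] at h1
  rw [expect]
  have hn : opNorm (hermPart (c • X)) ≤ opNorm X := by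
    refine (norm_hermPart_le _).trans ?_
    rw [norm_smul, hc, one_mul]
    exact le_rfl
  have hY' : 0 ≤ opNorm Y := norm_nonneg (E := Matrix _ _ ℂ) Y
  have hX' : 0 ≤ opNorm X := norm_nonneg (E := Matrix _ _ ℂ) X
  rw [Complex.norm_real, norm_norm] at h1
  refine h1.trans ?_
  have := regionDist_ge h₁ h₂ hdist
  gcongr

end Correlations
end SpinLattice

namespace SpinLattice

/-! ### Monotonicity of the rate function. -/

section RateFunctionProperties

theorem sStar_nonneg (x : ℝ) : 0 ≤ sStar x := (sStar_spec x).1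

/-- The critical point equation. It also holds at the boundary `s = 0`, where maximality forces `x ≤
0`. -/
theorem sStar_eq {x : ℝ} (hx : 0 ≤ x) : (Real.exp (sStar x) - 1) * (sStar x + 1) = x := by
  obtain ⟨h0, hmax⟩ := sStar_spec x
  have hd := hasDerivAt_rateObj x (sStar x)
  rcases h0.lt_or_eq with h | h
  · have hloc : IsLocalMax (rateObj x) (sStar x) := by
      filter_upwards [lt_mem_nhds h] with t ht using hmax t ht.le
    linarith [hloc.hasDerivAt_eq_zero hd]
  · rw [← h]
    rw [← h] at hmax
    have hc : Filter.Tendsto (fun t : ℝ => Real.exp t - 1 - t / 2) (nhdsWithin 0 (Set.Ioi 0))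
        (nhds (Real.exp 0 - 1 - 0 / 2)) :=
      (Continuous.tendsto (by fun_prop) 0).mono_left nhdsWithin_le_nhds
    have : x ≤ Real.exp 0 - 1 - 0 / 2 := by
      refine ge_of_tendsto hc ?_
      filter_upwards [self_mem_nhdsWithin] with t ht
      have ht : 0 < t := ht
      have h1 := hmax t ht.le
      simp only [rateObj, zero_mul] at h1
      nlinarith
    simp at this ⊢
    linarith

theorem expSub_strictMono :
    StrictMonoOn (fun s : ℝ => (Real.exp s - 1) * (s + 1)) (Set.Ici 0) := by
  intro a ha b _ hab
  have ha : 0 ≤ a := ha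
  have h1 : Real.exp a < Real.exp b := Real.exp_lt_exp.2 hab
  have h2 : 1 ≤ Real.exp a := Real.one_le_exp ha
  show (Real.exp a - 1) * (a + 1) < (Real.exp b - 1) * (b + 1)
  nlinarith

theorem sStar_strictMonoOn : StrictMonoOn sStar (Set.Ici 0) := by
  intro x hx y hy hxy
  by_contra! h
  have := expSub_strictMono.monotoneOn (sStar_nonneg y) (sStar_nonneg x) h
  simp only [sStar_eq (show 0 ≤ x from hx), sStar_eq (show 0 ≤ y from hy)] at this
  linarith

theorem sStar_zero : sStar 0 = 0 := by
  have h := sStar_eq le_rfl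
  have h0 := sStar_nonneg 0
  rcases mul_eq_zero.1 h with h | h
  · have : Real.exp (sStar 0) = 1 := by linarith
    simpa using this
  · linarith

theorem sStar_pos {x : ℝ} (hx : 0 < x) : 0 < sStar x := by
  have := sStar_strictMonoOn (Set.mem_Ici.2 le_rfl) (Set.mem_Ici.2 hx.le) hx
  rwa [sStar_zero] at this

theorem rateF_eq_mul {x : ℝ} (hx : 0 ≤ x) :
    rateF x = sStar x * (sStar x * (Real.exp (sStar x) - 1 / 2)) := by
  rw [rateF_eq, rateObj]
  have := sStar_eq hx
  linear_combination (-sStar x) * this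

theorem rateF_zero : rateF 0 = 0 := by
  rw [rateF_eq_mul le_rfl, sStar_zero]; simp

theorem rateF_pos {x : ℝ} (hx : 0 < x) : 0 < rateF x := by
  rw [rateF_eq_mul hx.le]
  have h := sStar_pos hx
  have h1 := Real.one_lt_exp_iff.2 h
  have : 0 < Real.exp (sStar x) - 1 / 2 := by linarith
  positivity

variable {k : ℕ} {d A ξ w : ℝ}

theorem bracket_zero : bracket k A ξ 0 = 0 := by
  simp [bracket, sStar_zero, rateF_zero]

theorem bracket_pos (hk : 1 ≤ k) (hA : 0 < A) (hξ : 0 < ξ) (hw : 0 < w) :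
    0 < bracket k A ξ w := by
  have hk' : (0 : ℝ) < k := by exact_mod_cast hk
  have h1 := sStar_pos (mul_pos hk' hw)
  have h2 := rateF_pos (mul_pos hk' hw)
  unfold bracket
  positivity

theorem costF_zero : costF k d A ξ 0 = 0 := by
  simp [costF, rateF_zero]

/-- With `F = sP`, the bracket is proportional to `s(k + P)`. Splitting off powers shows `f` as a
constant times two factors, each increasing in `s`, which makes strict monotonicity visible. -/
theorem costF_eq_of_pos (hk : 1 ≤ k) (hA : 0 < A) (hξ : 0 < ξ) (hw : 0 < w) {s P α : ℝ}
    (hs : s = sStar (k * w)) (hP : P = s * (Real.exp s - 1 / 2))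
    (hα : α = 2 * d / (2 * d + 1)) :
    costF k d A ξ w = (((k : ℝ) ^ 2 * A ^ 2) * (ξ / (k * A ^ 2)) ^ α)⁻¹ *
      ((s * P) ^ (1 - α) * (P / (k + P)) ^ α) := by
  have hk' : (0 : ℝ) < k := by exact_mod_cast hk
  have hs0 : 0 < s := hs ▸ sStar_pos (mul_pos hk' hw)
  have hP0 : 0 < P := by
    have h1 := Real.one_lt_exp_iff.2 hs0
    have : 0 < Real.exp s - 1 / 2 := by linarith
    rw [hP]; positivity
  have hF : rateF (k * w) = s * P := by
    rw [rateF_eq_mul (mul_pos hk' hw).le, ← hs, ← hP]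
  have e : k * s + s * P = s * (k + P) := by ring
  rw [costF, bracket, hF, ← hs, ← hα, e, Real.mul_rpow (by positivity) (by positivity),
    Real.mul_rpow hs0.le (by positivity), Real.div_rpow hP0.le (by positivity),
    Real.rpow_sub (by positivity), Real.rpow_one, Real.mul_rpow hs0.le hP0.le]
  have := Real.rpow_pos_of_pos hs0 α
  have := Real.rpow_pos_of_pos hP0 α
  have := Real.rpow_pos_of_pos (show 0 < k + P by positivity) α
  have := Real.rpow_pos_of_pos (show 0 < ξ / (k * A ^ 2) by positivity) α
  field_simp

theorem costF_pos (hk : 1 ≤ k) (hA : 0 < A) (hξ : 0 < ξ) (hw : 0 < w) :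
    0 < costF k d A ξ w := by
  have hk' : (0 : ℝ) < k := by exact_mod_cast hk
  have h1 := rateF_pos (mul_pos hk' hw)
  have h2 := bracket_pos hk hA hξ hw
  unfold costF
  positivity

theorem costF_strictMonoOn (hk : 1 ≤ k) (hd : 1 ≤ d) (hA : 0 < A) (hξ : 0 < ξ) :
    StrictMonoOn (costF k d A ξ) (Set.Ici 0) := by
  intro v hv w _ hvw
  have hk' : (0 : ℝ) < k := by exact_mod_cast hk
  rcases (show 0 ≤ v from hv).eq_or_lt with rfl | hv
  · rw [costF_zero]; exact costF_pos hk hA hξ hvw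
  have hw := hv.trans hvw
  rw [costF_eq_of_pos hk hA hξ hv rfl rfl rfl, costF_eq_of_pos hk hA hξ hw rfl rfl rfl]
  have hs : sStar (k * v) < sStar (k * w) :=
    sStar_strictMonoOn (mul_pos hk' hv).le (mul_pos hk' hw).le (by gcongr)
  set s := sStar (k * v) with hs_def
  set s' := sStar (k * w) with hs'_def
  have hs0 : 0 < s := sStar_pos (mul_pos hk' hv)
  have hs0' : 0 < s' := hs0.trans hs
  have h1 := Real.one_lt_exp_iff.2 hs0
  have h2 := Real.exp_lt_exp.2 hs
  have hP : s * (Real.exp s - 1 / 2) < s' * (Real.exp s' - 1 / 2) := by nlinarith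
  have hP0 : 0 < s * (Real.exp s - 1 / 2) := mul_pos hs0 (by linarith)
  set P := s * (Real.exp s - 1 / 2)
  set P' := s' * (Real.exp s' - 1 / 2)
  have hP0' := hP0.trans hP
  have hα : 2 * d / (2 * d + 1) < 1 := by rw [div_lt_one (by linarith)]; linarith
  have hα0 : 0 < 2 * d / (2 * d + 1) := by positivity
  have h3 : P / (k + P) < P' / (k + P') := by
    rw [div_lt_div_iff₀ (by positivity) (by positivity)]
    nlinarith
  have h4 : s * P < s' * P' := by nlinarith
  have h5 : (s * P) ^ (1 - 2 * d / (2 * d + 1)) < (s' * P') ^ (1 - 2 * d / (2 * d + 1)) :=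
    Real.rpow_lt_rpow (by positivity) h4 (by linarith)
  have h6 := Real.rpow_lt_rpow (by positivity) h3 hα0
  have h7 : 0 < (P / (k + P)) ^ (2 * d / (2 * d + 1)) := by positivity
  have h8 : 0 < (s * P) ^ (1 - 2 * d / (2 * d + 1)) := by positivity
  refine mul_lt_mul_of_pos_left (mul_lt_mul'' h5 h6 h8.le h7.le) (by positivity)

end RateFunctionProperties

end SpinLattice

namespace SpinLattice

open Matrix
open scoped MatrixOrder Matrix.Norms.L2Operator ComplexOrder

/-! ### Variational lower bound for the measured relative entropy. -/

section Variational

variable {ι : Type*} [Fintype ι] [DecidableEq ι]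

/-- One POVM, the projections on an eigenbasis, yields all moments of `G` from a single outcome
distribution. -/
theorem exists_spectral_projections {G : Matrix ι ι ℂ} (hG : G.IsHermitian) :
    ∃ (E : ι → Matrix ι ι ℂ) (l : ι → ℝ), (∀ i, (E i).PosSemidef) ∧ ∑ i, E i = 1 ∧
      ∀ m : ℕ, G ^ m = ∑ i, ((l i ^ m : ℝ) : ℂ) • E i := by
  set φ := Unitary.conjStarAlgAut ℂ _ hG.eigenvectorUnitary with hφ
  have hpow : ∀ m : ℕ, G ^ m = ∑ i, ((hG.eigenvalues i ^ m : ℝ) : ℂ) •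
      φ (diagonal (Pi.single i 1)) := by
    intro m
    conv_lhs => rw [hG.spectral_theorem]
    rw [← hφ, ← map_pow, diagonal_pow]
    simp only [← map_smul, ← map_sum]
    congr 1
    ext i j
    simp [Matrix.sum_apply, diagonal_apply, Pi.single_apply]
  refine ⟨fun i => φ (diagonal (Pi.single i 1)), hG.eigenvalues, fun i => ?_, ?_, hpow⟩
  · simp only [hφ, Unitary.conjStarAlgAut_apply]
    refine PosSemidef.mul_mul_conjTranspose_same (PosSemidef.diagonal ?_) _
    intro j
    by_cases h : j = i
    · subst h; simp
    · simp [h]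
  · simpa using (hpow 0).symm

/-- This is `log x ≤ x - 1` at `x = q e^l / (Z p)`. Summed over outcomes with `∑ p = 1` and `∑ q e^l
≤ Z`, it becomes the Gibbs variational inequality. -/
theorem le_klTerm {p q l Z : ℝ} (hp : 0 ≤ p) (hq : 0 ≤ q) (hZ : 0 < Z) :
    ((p * (l - Real.log Z) + p - q * Real.exp l / Z : ℝ) : EReal) ≤ klTerm p q := by
  unfold klTerm
  split_ifs with h1 h2
  · subst h1
    have : 0 ≤ q * Real.exp l / Z := by positivity
    have h : (0 : ℝ) * (l - Real.log Z) + 0 - q * Real.exp l / Z ≤ 0 := by linarith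
    exact_mod_cast h
  · exact le_top
  · have hp' : 0 < p := lt_of_le_of_ne hp (Ne.symm h1)
    have hq' : 0 < q := lt_of_le_of_ne hq (Ne.symm h2)
    have h := Real.log_le_sub_one_of_pos (show 0 < q * Real.exp l / (Z * p) by positivity)
    rw [Real.log_div (by positivity) (by positivity), Real.log_mul (by positivity)
      (by positivity), Real.log_mul (by positivity) (by positivity), Real.log_exp] at h
    rw [EReal.coe_le_coe_iff, Real.log_div h1 h2]
    have h' := mul_le_mul_of_nonneg_left h hp
    have e : p * (q * Real.exp l / (Z * p) - 1) = q * Real.exp l / Z - p := by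
      field_simp
    rw [e] at h'
    linarith

theorem coe_sum_le_sum {m : ℕ} (f : Fin m → ℝ) (g : Fin m → EReal)
    (h : ∀ i, ((f i : ℝ) : EReal) ≤ g i) : ((∑ i, f i : ℝ) : EReal) ≤ ∑ i, g i := by
  have e : ((∑ i, f i : ℝ) : EReal) = ∑ i, ((f i : ℝ) : EReal) :=
    map_sum (⟨⟨Real.toEReal, EReal.coe_zero⟩, EReal.coe_add⟩ : ℝ →+ EReal) f Finset.univ
  rw [e]
  exact Finset.sum_le_sum fun i _ => h i

theorem measuredRelEntropy_nonneg {ρ σ : Matrix ι ι ℂ} (hρ : IsState ρ) (hσ : IsState σ) :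
    0 ≤ measuredRelEntropy ρ σ := by
  refine le_sSup ⟨1, fun _ => 1, ⟨fun _ => PosSemidef.one, by simp⟩, ?_⟩
  simp [hρ.2, hσ.2, klTerm]

/-- The measured relative entropy bounds expectation values minus the logarithm of the moment
generating function. -/
theorem le_measuredRelEntropy {ρ σ G : Matrix ι ι ℂ} (hρ : IsState ρ) (hσ : IsState σ)
    (hG : G.IsHermitian) {t Z : ℝ}
    (hZ : ∀ N : ℕ, ∑ m ∈ Finset.range N, t ^ m / m.factorial * (σ * G ^ m).trace.re ≤ Z) :
    ((t * (ρ * G).trace.re - Real.log Z : ℝ) : EReal) ≤ measuredRelEntropy ρ σ := by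
  obtain ⟨E, l, hE, hE1, hpow⟩ := exists_spectral_projections hG
  have htr : ∀ (ω : Matrix ι ι ℂ) (m : ℕ),
      (ω * G ^ m).trace.re = ∑ i, l i ^ m * (E i * ω).trace.re := by
    intro ω m
    rw [hpow, Matrix.mul_sum, Matrix.trace_sum, Complex.re_sum]
    refine Finset.sum_congr rfl fun i _ => ?_
    rw [Matrix.mul_smul, Matrix.trace_smul, Matrix.trace_mul_comm ω, smul_eq_mul,
      Complex.re_ofReal_mul]
  have hone : ∀ ω : Matrix ι ι ℂ, IsState ω → ∑ i, (E i * ω).trace.re = 1 := by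
    intro ω hω
    have := htr ω 0
    simp [hω.2] at this
    exact this.symm
  set e := Fintype.equivFin ι
  have hZ0 : 0 < Z := by
    have := hZ 1
    simp [hσ.2] at this
    linarith
  have hlim : ∑ i, (E i * σ).trace.re * Real.exp (t * l i) ≤ Z := by
    have hs : HasSum (fun m : ℕ => t ^ m / m.factorial * (σ * G ^ m).trace.re)
        (∑ i, (E i * σ).trace.re * Real.exp (t * l i)) := by
      simp only [htr, Finset.mul_sum]
      refine hasSum_sum fun i _ => ?_
      have h := (NormedSpace.expSeries_div_hasSum_exp (t * l i)).mul_left (E i * σ).trace.re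
      rw [← Real.exp_eq_exp_ℝ] at h
      refine h.congr_fun fun m => ?_
      rw [mul_pow]
      ring
    exact le_of_tendsto hs.tendsto_sum_nat (Filter.Eventually.of_forall hZ)
  refine le_trans ?_ (le_sSup ⟨Fintype.card ι, fun a => E (e.symm a),
    ⟨fun a => hE _, by rw [e.symm.sum_comp E]; exact hE1⟩, rfl⟩)
  refine le_trans ?_ (coe_sum_le_sum _ _ fun a => le_klTerm (l := t * l (e.symm a))
    (trace_mul_posSemidef_nonneg hρ.1 (hE _)) (trace_mul_posSemidef_nonneg hσ.1 (hE _)) hZ0)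
  rw [EReal.coe_le_coe_iff, e.symm.sum_comp (fun i => (E i * ρ).trace.re * (t * l i - Real.log Z)
    + (E i * ρ).trace.re - (E i * σ).trace.re * Real.exp (t * l i) / Z)]
  have h1 := htr ρ 1
  have h2 : ∑ i, ((E i * ρ).trace.re * (t * l i - Real.log Z)
      + (E i * ρ).trace.re - (E i * σ).trace.re * Real.exp (t * l i) / Z)
      = t * ∑ i, l i ^ 1 * (E i * ρ).trace.re - Real.log Z * ∑ i, (E i * ρ).trace.re
        + ∑ i, (E i * ρ).trace.re - (∑ i, (E i * σ).trace.re * Real.exp (t * l i)) / Z := by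
    rw [Finset.mul_sum, Finset.mul_sum, Finset.sum_div, ← Finset.sum_sub_distrib,
      ← Finset.sum_add_distrib, ← Finset.sum_sub_distrib]
    exact Finset.sum_congr rfl fun i _ => by ring
  rw [h2, ← h1, pow_one, hone ρ hρ]
  have h3 := div_le_one_of_le₀ hlim hZ0.le
  linarith

end Variational

end SpinLattice

namespace SpinLattice

/-! ### Peeling stars off graphs without isolated vertices. -/

section Clusters

open scoped Classical in
/-- In a graph without isolated vertices, every vertex `v` lies in a star (with centre `u` and
vertex set `Q`) whose removal leaves no isolated vertex. -/
theorem exists_star {ι : Type*} [Fintype ι] {R : ι → ι → Prop} (hR : ∀ i j, R i j → R j i)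
    (h : ∀ i, ∃ j, j ≠ i ∧ R i j) (v : ι) :
    ∃ (Q : Finset ι) (u : ι), v ∈ Q ∧ u ∈ Q ∧ 2 ≤ Q.card ∧ (Q.card = 2 → u = v) ∧
      (∀ i ∈ Q, i ≠ u → R u i) ∧ ∀ i, i ∉ Q → ∃ j, j ∉ Q ∧ j ≠ i ∧ R i j := by
  -- `I` consists of the vertices whose only neighbour is `v`; if there are any, they form a star
  -- around `v`.
  set I : Finset ι := Finset.univ.filter fun i => i ≠ v ∧ ∀ j, j ≠ v → j ≠ i → ¬ R i j with hI
  by_cases hIe : I.Nonempty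
  · refine ⟨insert v I, v, by simp, by simp, ?_, fun _ => rfl, ?_, ?_⟩
    · rw [Finset.card_insert_of_notMem (by simp [hI])]
      have := hIe.card_pos
      omega
    · intro i hi hiv
      have hi : i ∈ I := (Finset.mem_insert.1 hi).resolve_left hiv
      rw [hI, Finset.mem_filter] at hi
      obtain ⟨j, hj, hij⟩ := h i
      by_cases hjv : j = v
      · subst hjv; exact hR _ _ hij
      · exact absurd hij (hi.2.2 j hjv hj)
    · intro i hi
      rw [Finset.mem_insert, not_or] at hi
      obtain ⟨hiv, hiI⟩ := hi
      have : ∃ j, j ≠ v ∧ j ≠ i ∧ R i j := by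
        by_contra! hc
        exact hiI (by simp only [hI, Finset.mem_filter]; exact ⟨Finset.mem_univ _, hiv, hc⟩)
      obtain ⟨j, hjv, hji, hij⟩ := this
      refine ⟨j, ?_, hji, hij⟩
      rw [Finset.mem_insert, not_or]
      refine ⟨hjv, fun hjI => ?_⟩
      rw [hI, Finset.mem_filter] at hjI
      exact hjI.2.2 i hiv hji.symm (hR _ _ hij)
  -- Now remove `v` together with a neighbour `u`. A vertex isolated by this has a neighbour other
  -- than `v`, which must be `u`, so `u` can be the centre.
  · have hI' : ∀ i, i ≠ v → ∃ j, j ≠ v ∧ j ≠ i ∧ R i j := by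
      intro i hiv
      by_contra! hc
      exact hIe ⟨i, by simp only [hI, Finset.mem_filter]; exact ⟨Finset.mem_univ _, hiv, hc⟩⟩
    obtain ⟨u, huv, hvu⟩ := h v
    set J : Finset ι := Finset.univ.filter fun i =>
      i ≠ v ∧ i ≠ u ∧ ∀ j, j ≠ v → j ≠ u → j ≠ i → ¬ R i j with hJ
    have hJu : ∀ i ∈ J, R u i := by
      intro i hi
      rw [hJ, Finset.mem_filter] at hi
      obtain ⟨j, hjv, hji, hij⟩ := hI' i hi.2.1
      by_cases hju : j = u
      · subst hju; exact hR _ _ hij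
      · exact absurd hij (hi.2.2.2 j hjv hju hji)
    have hrest : ∀ i, i ∉ insert v (insert u J) →
        ∃ j, j ∉ insert v (insert u J) ∧ j ≠ i ∧ R i j := by
      intro i hi
      simp only [Finset.mem_insert, not_or] at hi
      obtain ⟨hiv, hiu, hiJ⟩ := hi
      have : ∃ j, j ≠ v ∧ j ≠ u ∧ j ≠ i ∧ R i j := by
        by_contra! hc
        exact hiJ (by simp only [hJ, Finset.mem_filter]; exact ⟨Finset.mem_univ _, hiv, hiu, hc⟩)
      obtain ⟨j, hjv, hju, hji, hij⟩ := this
      refine ⟨j, ?_, hji, hij⟩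
      simp only [Finset.mem_insert, not_or]
      refine ⟨hjv, hju, fun hjJ => ?_⟩
      rw [hJ, Finset.mem_filter] at hjJ
      exact hjJ.2.2.2 i hiv hiu hji.symm (hR _ _ hij)
    have hcard : (insert v (insert u J)).card = J.card + 2 := by
      rw [Finset.card_insert_of_notMem (by simp [hJ, huv.symm]),
        Finset.card_insert_of_notMem (by simp [hJ])]
    -- The star is a single edge, and either end could be its centre; choosing `v` prevents counting
    -- it twice.
    by_cases hJe : J = ∅
    · refine ⟨insert v (insert u J), v, by simp, by simp, by omega, fun _ => rfl, ?_, hrest⟩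
      intro i hi hiv
      simp only [hJe, Finset.mem_insert, Finset.notMem_empty, or_false] at hi
      rw [hi.resolve_left hiv]; exact hvu
    · have := (Finset.nonempty_iff_ne_empty.2 hJe).card_pos
      refine ⟨insert v (insert u J), u, by simp, by simp, by omega, by omega, ?_, hrest⟩
      intro i hi hiu
      rcases Finset.mem_insert.1 hi with rfl | hi
      · exact hR _ _ hvu
      · exact hJu i ((Finset.mem_insert.1 hi).resolve_left hiu)

variable {W : Type*} [Fintype W]

/-- No member of the tuple `f` is isolated with respect to the relation `N`. -/
def NoIsolated (N : W → W → Prop) {ι : Type*} (f : ι → W) : Prop :=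
  ∀ i, ∃ j, j ≠ i ∧ N (f i) (f j)

open scoped Classical in
/-- The weight of a tuple without isolated members, and zero for the other tuples. -/
noncomputable def clusterWeight (N : W → W → Prop) (w : W → ℝ) {ι : Type*} [Fintype ι]
    (f : ι → W) : ℝ :=
  if NoIsolated N f then ∏ i, w (f i) else 0

open scoped Classical in
/-- The weight of a tuple in which all members are related to the one labelled `u`, and zero
for the other tuples. -/
noncomputable def starWeight (N : W → W → Prop) (w : W → ℝ) {ι : Type*} [Fintype ι] (u : ι)
    (f : ι → W) : ℝ :=
  if ∀ i, i ≠ u → N (f u) (f i) then ∏ i, w (f i) else 0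

/-- The total weight of the tuples without isolated members. -/
noncomputable def clusterSum (N : W → W → Prop) (w : W → ℝ) (ι : Type*) [Fintype ι]
    [DecidableEq ι] : ℝ :=
  ∑ f : ι → W, clusterWeight N w f

/-- The total weight of the tuples in which all members are related to the one labelled `u`. -/
noncomputable def starSum (N : W → W → Prop) (w : W → ℝ) {ι : Type*} [Fintype ι]
    [DecidableEq ι] (u : ι) : ℝ :=
  ∑ f : ι → W, starWeight N w u f

open scoped Classical in
/-- The total weight of the elements related to `x`. -/
noncomputable def weightedDegree (N : W → W → Prop) (w : W → ℝ) (x : W) : ℝ :=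
  ∑ y, if N x y then w y else 0

variable {N : W → W → Prop} {w : W → ℝ}

omit [Fintype W] in
theorem clusterWeight_nonneg (hw : ∀ x, 0 ≤ w x) {ι : Type*} [Fintype ι] (f : ι → W) :
    0 ≤ clusterWeight N w f := by
  unfold clusterWeight
  split_ifs
  · exact Finset.prod_nonneg fun i _ => hw _
  · exact le_rfl

omit [Fintype W] in
theorem starWeight_nonneg (hw : ∀ x, 0 ≤ w x) {ι : Type*} [Fintype ι] (u : ι) (f : ι → W) :
    0 ≤ starWeight N w u f := by
  unfold starWeight
  split_ifs
  · exact Finset.prod_nonneg fun i _ => hw _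
  · exact le_rfl

theorem clusterSum_nonneg (hw : ∀ x, 0 ≤ w x) (ι : Type*) [Fintype ι] [DecidableEq ι] :
    0 ≤ clusterSum N w ι :=
  Finset.sum_nonneg fun f _ => clusterWeight_nonneg hw f

theorem weightedDegree_nonneg (hw : ∀ x, 0 ≤ w x) (x : W) : 0 ≤ weightedDegree N w x := by
  refine Finset.sum_nonneg fun y _ => ?_
  split_ifs
  · exact hw y
  · exact le_rfl

theorem clusterSum_congr {ι ι' : Type*} [Fintype ι] [Fintype ι'] [DecidableEq ι]
    [DecidableEq ι'] (e : ι ≃ ι') : clusterSum N w ι = clusterSum N w ι' := by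
  unfold clusterSum
  refine Fintype.sum_equiv (e.arrowCongr (Equiv.refl W)) _ _ fun f => ?_
  have h : NoIsolated N (e.arrowCongr (Equiv.refl W) f) ↔ NoIsolated N f := by
    simp only [NoIsolated, Equiv.arrowCongr_apply, Equiv.coe_refl, Function.comp, id]
    constructor
    · intro h i
      obtain ⟨j, hj, hN⟩ := h (e i)
      refine ⟨e.symm j, fun h => hj (by rw [← h]; simp), by simpa using hN⟩
    · intro h i
      obtain ⟨j, hj, hN⟩ := h (e.symm i)
      exact ⟨e j, fun h => hj (by rw [← h]; simp), by simpa using hN⟩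
  have hp : ∏ i, w (f i) = ∏ i, w (e.arrowCongr (Equiv.refl W) f i) :=
    Fintype.prod_equiv e _ _ fun i => by simp [Equiv.arrowCongr_apply]
  unfold clusterWeight
  by_cases hf : NoIsolated N f
  · rw [if_pos hf, if_pos (h.2 hf), hp]
  · rw [if_neg hf, if_neg (mt h.1 hf)]

/-- Once the value at the centre is fixed, the other members range independently over the elements
related to it. -/
theorem starSum_eq {ι : Type*} [Fintype ι] [DecidableEq ι] (u : ι) :
    starSum N w u = ∑ x, w x * weightedDegree N w x ^ (Fintype.card ι - 1) := by
  classical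
  unfold starSum starWeight
  rw [Fintype.sum_equiv (Equiv.funSplitAt u W) _
    (fun p => w p.1 * ∏ j : {j // j ≠ u}, if N p.1 (p.2 j) then w (p.2 j) else 0),
    Fintype.sum_prod_type]
  · refine Finset.sum_congr rfl fun x _ => ?_
    have h := (Finset.prod_univ_sum (fun _ : {j // j ≠ u} => (Finset.univ : Finset W))
      (fun _ y => if N x y then w y else 0)).symm
    rw [Fintype.piFinset_univ] at h
    rw [Finset.prod_const, Finset.card_univ, Fintype.card_subtype_compl] at h
    simp only [Fintype.card_unique] at h
    rw [weightedDegree, ← h, Finset.mul_sum]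
  · intro f
    rw [Finset.prod_ite_zero, Fintype.prod_eq_mul_prod_subtype_ne (fun i => w (f i)) u]
    simp [Equiv.funSplitAt, Equiv.piSplitAt]

theorem sum_split {ι : Type*} [Fintype ι] [DecidableEq ι] (Q : Finset ι)
    (a : ({i // i ∈ Q} → W) → ℝ) (b : ({i // i ∉ Q} → W) → ℝ) :
    ∑ f : ι → W, a (fun i => f i) * b (fun i => f i) = (∑ g, a g) * ∑ g, b g := by
  rw [Finset.sum_mul_sum, ← Fintype.sum_prod_type']
  exact Fintype.sum_equiv (Equiv.piEquivPiSubtypeProd (· ∈ Q) (fun _ => W)) _ _ fun f => rfl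

/-- `exists_star` factorizes each contributing tuple into a star through `v` and a tuple again
without isolated members. Several factorizations may exist; overcounting is harmless since weights
are nonnegative. -/
theorem clusterSum_le_sum_star {ι : Type*} [Fintype ι] [DecidableEq ι]
    (hN : ∀ x y, N x y → N y x) (hw : ∀ x, 0 ≤ w x) (v : ι) :
    clusterSum N w ι ≤ ∑ Q : Finset ι with v ∈ Q ∧ 2 ≤ Q.card,
      ∑ u ∈ (Finset.univ : Finset {i // i ∈ Q}).filter (fun u : {i // i ∈ Q} => Q.card = 2 → (u : ι) = v),
        starSum N w u * clusterSum N w {i // i ∉ Q} := by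
  have hterm : ∀ f : ι → W, clusterWeight N w f ≤
      ∑ Q : Finset ι with v ∈ Q ∧ 2 ≤ Q.card,
        ∑ u ∈ (Finset.univ : Finset {i // i ∈ Q}).filter (fun u : {i // i ∈ Q} => Q.card = 2 → (u : ι) = v),
          starWeight N w u (fun i : {i // i ∈ Q} => f i) *
            clusterWeight N w (fun i : {i // i ∉ Q} => f i) := by
    intro f
    have hprod : ∀ (Q : Finset ι) (u : {i // i ∈ Q}), 0 ≤
        starWeight N w u (fun i : {i // i ∈ Q} => f i) *
          clusterWeight N w (fun i : {i // i ∉ Q} => f i) := fun Q u =>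
      mul_nonneg (starWeight_nonneg hw _ _) (clusterWeight_nonneg hw _)
    by_cases hf : NoIsolated N f
    · obtain ⟨Q, u, hv, hu, h2, h2', hstar, hrest⟩ :=
        exists_star (R := fun i j => N (f i) (f j)) (fun i j => hN _ _) hf v
      refine le_trans ?_ (Finset.single_le_sum
        (fun Q _ => Finset.sum_nonneg fun u _ => hprod Q u)
        (Finset.mem_filter.2 ⟨Finset.mem_univ Q, hv, h2⟩))
      refine le_trans ?_ (Finset.single_le_sum (fun u _ => hprod Q u)
        (Finset.mem_filter.2 ⟨Finset.mem_univ (⟨u, hu⟩ : {i // i ∈ Q}), h2'⟩))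
      unfold starWeight clusterWeight
      rw [if_pos hf, if_pos, if_pos]
      · convert (Fintype.prod_subtype_mul_prod_subtype (fun i => i ∈ Q) (fun i => w (f i))).ge
      · rintro ⟨i, hi⟩
        obtain ⟨j, hj, hji, hij⟩ := hrest i hi
        exact ⟨⟨j, hj⟩, fun h => hji (congrArg Subtype.val h), hij⟩
      · rintro ⟨i, hi⟩ hiu
        exact hstar i hi fun h => hiu (Subtype.ext h)
    · rw [clusterWeight, if_neg hf]
      exact Finset.sum_nonneg fun Q _ => Finset.sum_nonneg fun u _ => hprod Q u
  refine (Finset.sum_le_sum fun f _ => hterm f).trans (le_of_eq ?_)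
  rw [Finset.sum_comm]
  refine Finset.sum_congr rfl fun Q _ => ?_
  rw [Finset.sum_comm]
  refine Finset.sum_congr rfl fun u _ => ?_
  exact sum_split Q (starWeight N w u) (clusterWeight N w)

/-- The number of labelled stars with `p + 1` vertices, times the bound on the weight of one. -/
noncomputable def starCoeff (T κ : ℝ) (p : ℕ) : ℝ :=
  if p = 0 then 0 else (if p = 1 then 1 else (p + 1 : ℝ)) * (T * κ ^ (p - 1))

/-- One power of the degree is spent on `T`, the rest on `κ`. Elements of weight zero are exempt
from the bound `κ`, because only regions with a nonzero term are known to have at most `k` spins. -/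
theorem starSum_le {T κ : ℝ} (hw : ∀ x, 0 ≤ w x)
    (hκ : ∀ x, w x ≠ 0 → weightedDegree N w x ≤ κ)
    (hT : ∑ x, w x * weightedDegree N w x ≤ T) {ι : Type*} [Fintype ι] [DecidableEq ι] (u : ι)
    {p : ℕ} (hp : Fintype.card ι = p + 2) (hκ0 : 0 ≤ κ) :
    starSum N w u ≤ T * κ ^ p := by
  rw [starSum_eq, hp, show p + 2 - 1 = p + 1 by omega]
  refine le_trans ?_ (mul_le_mul_of_nonneg_right hT (pow_nonneg hκ0 p))
  rw [Finset.sum_mul]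
  refine Finset.sum_le_sum fun x _ => ?_
  by_cases hx : w x = 0
  · simp [hx]
  · rw [pow_succ', ← mul_assoc]
    have h0 := weightedDegree_nonneg (N := N) hw x
    have := hw x
    gcongr
    exact hκ x hx

/-- The star is peeled at the label `none`; its other members form a `p`-subset of `m` labels,
whence the binomial, and `starCoeff` counts the possible centres. -/
theorem clusterSum_succ_le {T κ : ℝ} (hN : ∀ x y, N x y → N y x) (hw : ∀ x, 0 ≤ w x)
    (hκ : ∀ x, w x ≠ 0 → weightedDegree N w x ≤ κ)
    (hT : ∑ x, w x * weightedDegree N w x ≤ T) (hκ0 : 0 ≤ κ) (m : ℕ) :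
    clusterSum N w (Fin (m + 1)) ≤ ∑ p ∈ Finset.range (m + 1),
      (m.choose p : ℝ) * (starCoeff T κ p * clusterSum N w (Fin (m - p))) := by
  have hT0 : 0 ≤ T := le_trans (Finset.sum_nonneg fun x _ =>
    mul_nonneg (hw x) (weightedDegree_nonneg hw x)) hT
  rw [clusterSum_congr (finSuccEquiv m)]
  refine (clusterSum_le_sum_star hN hw none).trans ?_
  have h1 : ∀ Q : Finset (Option (Fin m)), none ∈ Q ∧ 2 ≤ Q.card →
      ∑ u ∈ (Finset.univ : Finset {i // i ∈ Q}).filter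
          (fun u : {i // i ∈ Q} => Q.card = 2 → (u : Option (Fin m)) = none),
        starSum N w u * clusterSum N w {i // i ∉ Q} ≤
      starCoeff T κ (Q.card - 1) * clusterSum N w (Fin (m - (Q.card - 1))) := by
    rintro Q ⟨hQ0, hQ2⟩
    have hcard : Fintype.card {i // i ∉ Q} = m - (Q.card - 1) := by
      rw [Fintype.card_subtype_compl]
      simp
      omega
    rw [clusterSum_congr (Fintype.equivFinOfCardEq hcard), ← Finset.sum_mul]
    refine mul_le_mul_of_nonneg_right ?_ (clusterSum_nonneg hw _)
    have h2 : ∀ u : {i // i ∈ Q}, starSum N w u ≤ T * κ ^ (Q.card - 2) := fun u =>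
      starSum_le hw hκ hT u (by simp; omega) hκ0
    refine (Finset.sum_le_sum fun u _ => h2 u).trans ?_
    rw [Finset.sum_const, nsmul_eq_mul, starCoeff, if_neg (by omega),
      show Q.card - 1 - 1 = Q.card - 2 by omega]
    refine mul_le_mul_of_nonneg_right ?_ (by positivity)
    split_ifs with h3
    · have : Q.card = 2 := by omega
      norm_cast
      rw [Finset.card_le_one]
      intro a ha b hb
      simp only [Finset.mem_filter, Finset.mem_univ, true_and] at ha hb
      exact Subtype.ext ((ha this).trans (hb this).symm)
    · have := Finset.card_filter_le (Finset.univ : Finset {i // i ∈ Q})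
        (fun u : {i // i ∈ Q} => Q.card = 2 → (u : Option (Fin m)) = none)
      rw [Finset.card_univ, Fintype.card_coe] at this
      norm_cast
      omega
  have hnn : ∀ p, 0 ≤ starCoeff T κ p * clusterSum N w (Fin (m - p)) := by
    intro p
    refine mul_nonneg ?_ (clusterSum_nonneg hw _)
    unfold starCoeff
    split_ifs <;> positivity
  refine (Finset.sum_le_sum fun Q hQ => h1 Q (Finset.mem_filter.1 hQ).2).trans ?_
  have h4 := Finset.sum_powerset_apply_card
    (fun p => starCoeff T κ p * clusterSum N w (Fin (m - p))) (x := (Finset.univ : Finset (Fin m)))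
  simp only [Finset.powerset_univ, Finset.card_univ, Fintype.card_fin, nsmul_eq_mul] at h4
  rw [← h4]
  have h5 : ∀ P : Finset (Fin m), starCoeff T κ P.card * clusterSum N w (Fin (m - P.card)) =
      starCoeff T κ ((Finset.insertNone P).card - 1) *
        clusterSum N w (Fin (m - ((Finset.insertNone P).card - 1))) := by
    intro P
    rw [Finset.card_insertNone, Nat.add_sub_cancel]
  rw [Finset.sum_congr rfl fun P _ => h5 P, ← Finset.sum_image
    (f := fun Q : Finset (Option (Fin m)) => starCoeff T κ (Q.card - 1) *
      clusterSum N w (Fin (m - (Q.card - 1)))) (g := fun P => Finset.insertNone P)]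
  · refine Finset.sum_le_sum_of_subset_of_nonneg ?_ fun Q _ _ => hnn _
    intro Q hQ
    rw [Finset.mem_filter] at hQ
    refine Finset.mem_image.2 ⟨Finset.eraseNone Q, Finset.mem_univ _, ?_⟩
    rw [Finset.insertNone_eraseNone, Finset.insert_eq_of_mem hQ.2.1]
  · intro P _ P' _ h
    exact Finset.insertNone.injective h

end Clusters

/-! ### Exponential generating function of the star recursion. -/

section GeneratingFunction

/-- The exponent in the bound on the moment generating function. -/
noncomputable def mgfExponent (s : ℝ) : ℝ := s * (Real.exp s - 1 - s / 2)

theorem hasDerivAt_mgfExponent (s : ℝ) :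
    HasDerivAt mgfExponent (s * Real.exp s + Real.exp s - 1 - s) s := by
  have h := (hasDerivAt_id s).mul
    (((Real.hasDerivAt_exp s).sub_const 1).sub ((hasDerivAt_id s).div_const 2))
  refine (h.congr_deriv ?_)
  simp
  ring

/-- With `s = κt`, the series of `(p+1) s^p / p!` sums to `s e^s + e^s`. Dropping `p = 0` gives
`-1`, and counting an edge once instead of twice gives `-s`, the origin of the term `s/2` in `F`.
The result is the derivative of `mgfExponent`. -/
theorem sum_starCoeff_le {T κ t : ℝ} (hT : 0 ≤ T) (hκ : 0 < κ) (ht : 0 ≤ t) (M : ℕ) :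
    ∑ p ∈ Finset.range M, starCoeff T κ p * t ^ p / p.factorial ≤
      T / κ * (κ * t * Real.exp (κ * t) + Real.exp (κ * t) - 1 - κ * t) := by
  set s := κ * t with hs
  have hs0 : 0 ≤ s := by positivity
  have key : ∀ M : ℕ, ∑ p ∈ Finset.range (M + 2), starCoeff T κ p * t ^ p / p.factorial =
      T / κ * (s * ∑ p ∈ Finset.range (M + 1), s ^ p / p.factorial +
        ∑ p ∈ Finset.range (M + 2), s ^ p / p.factorial - 1 - s) := by
    intro M
    induction M with
    | zero =>
      simp [Finset.sum_range_succ, starCoeff, hs]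
      field_simp
      ring
    | succ M ih =>
      rw [Finset.sum_range_succ, ih, Finset.sum_range_succ (fun p => s ^ p / p.factorial) (M + 2),
        Finset.sum_range_succ (fun p => s ^ p / p.factorial) (M + 1), starCoeff,
        if_neg (by omega), if_neg (by omega), hs, mul_pow, mul_pow,
        Nat.factorial_succ (M + 1), show M + 2 - 1 = M + 1 by omega]
      have : ((M + 1).factorial : ℝ) ≠ 0 := by positivity
      have : ((M + 1 + 1 : ℕ) : ℝ) ≠ 0 := by positivity
      push_cast at this ⊢
      field_simp
      ring
  have hnn : ∀ p, 0 ≤ starCoeff T κ p * t ^ p / p.factorial := by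
    intro p
    unfold starCoeff
    split_ifs <;> positivity
  refine (Finset.sum_le_sum_of_subset_of_nonneg
    (Finset.range_mono (show M ≤ M + 2 by omega)) fun p _ _ => hnn p).trans ?_
  rw [key]
  have h1 := Real.sum_le_exp_of_nonneg hs0 (M + 1)
  have h2 := Real.sum_le_exp_of_nonneg hs0 (M + 2)
  gcongr

/-- A sequence satisfying the recursive inequality of the partitions into stars has its
exponential generating function bounded by the exponential of the one of the stars. -/
theorem sum_le_exp_mgfExponent {T κ : ℝ} (hT : 0 ≤ T) (hκ : 0 < κ) {a : ℕ → ℝ}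
    (ha : ∀ m, 0 ≤ a m) (ha0 : a 0 ≤ 1)
    (hrec : ∀ m, a (m + 1) ≤ ∑ p ∈ Finset.range (m + 1),
      (m.choose p : ℝ) * (starCoeff T κ p * a (m - p))) {t : ℝ} (ht : 0 ≤ t) (M : ℕ) :
    ∑ m ∈ Finset.range M, a m * t ^ m / m.factorial ≤
      Real.exp (T / κ ^ 2 * mgfExponent (κ * t)) := by
  have hcnn : ∀ p, 0 ≤ starCoeff T κ p := by
    intro p
    unfold starCoeff
    split_ifs <;> positivity
  -- The extra term makes the derivative of the truncation have exactly `M` terms.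
  have hbig : ∑ m ∈ Finset.range M, a m * t ^ m / m.factorial ≤
      ∑ m ∈ Finset.range (M + 1), a m * t ^ m / m.factorial :=
    Finset.sum_le_sum_of_subset_of_nonneg (Finset.range_mono (by omega)) fun m _ _ => by
      have := ha m
      positivity
  refine hbig.trans ?_
  set P : ℝ → ℝ := fun t => ∑ m ∈ Finset.range (M + 1), a m * t ^ m / m.factorial with hP
  set P' : ℝ → ℝ := fun t => ∑ m ∈ Finset.range M, a (m + 1) * t ^ m / m.factorial with hP'
  have hderiv : ∀ t, HasDerivAt P (P' t) t := by
    intro t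
    have h : HasDerivAt P (∑ m ∈ Finset.range (M + 1),
        a m * (m * t ^ (m - 1)) / m.factorial) t :=
      HasDerivAt.fun_sum fun m _ => ((hasDerivAt_pow m t).const_mul (a m)).div_const _
    refine h.congr_deriv ?_
    rw [Finset.sum_range_succ', hP']
    simp only [Nat.cast_zero, zero_mul, mul_zero, zero_div, add_zero]
    refine Finset.sum_congr rfl fun m _ => ?_
    rw [Nat.factorial_succ, Nat.add_sub_cancel]
    push_cast
    have : (m.factorial : ℝ) ≠ 0 := by positivity
    have : (m : ℝ) + 1 ≠ 0 := by positivity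
    field_simp
  set D : ℝ → ℝ := fun t => T / κ * (κ * t * Real.exp (κ * t) + Real.exp (κ * t) - 1 - κ * t)
    with hD
  -- The recursion is a truncated convolution, all of whose terms occur in the product of the two
  -- truncated sums.
  have hbound : ∀ t, 0 ≤ t → P' t ≤ D t * P t := by
    intro t ht
    refine le_trans ?_ (mul_le_mul_of_nonneg_right (sum_starCoeff_le hT hκ ht M)
      (Finset.sum_nonneg fun m _ => by have := ha m; positivity))
    rw [Finset.sum_mul_sum]
    have h1 : ∀ m ∈ Finset.range M, a (m + 1) * t ^ m / m.factorial ≤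
        ∑ p ∈ Finset.range M, if p ≤ m then (starCoeff T κ p * t ^ p / p.factorial) *
          (a (m - p) * t ^ (m - p) / (m - p).factorial) else 0 := by
      intro m hm
      rw [← Finset.sum_filter]
      have e : Finset.filter (fun p => p ≤ m) (Finset.range M) = Finset.range (m + 1) := by
        ext p
        simp only [Finset.mem_filter, Finset.mem_range] at hm ⊢
        omega
      rw [e]
      have h2 := mul_le_mul_of_nonneg_right (hrec m)
        (show 0 ≤ t ^ m / m.factorial by positivity)
      rw [mul_div_assoc]
      refine h2.trans (le_of_eq ?_)
      rw [Finset.sum_mul]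
      refine Finset.sum_congr rfl fun p hp => ?_
      have hp : p ≤ m := by simpa [Nat.lt_succ_iff] using hp
      rw [Nat.cast_choose ℝ hp]
      have e2 : t ^ m = t ^ p * t ^ (m - p) := by rw [← pow_add]; congr 1; omega
      rw [e2]
      have : (m.factorial : ℝ) ≠ 0 := by positivity
      have : (p.factorial : ℝ) ≠ 0 := by positivity
      have : ((m - p).factorial : ℝ) ≠ 0 := by positivity
      field_simp
    refine (Finset.sum_le_sum h1).trans ?_
    rw [Finset.sum_comm]
    refine Finset.sum_le_sum fun p _ => ?_
    rw [← Finset.sum_filter]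
    have hnn : ∀ j, 0 ≤ starCoeff T κ p * t ^ p / p.factorial *
        (a j * t ^ j / j.factorial) := fun j => by
      have := ha j
      have := hcnn p
      positivity
    rw [← Finset.sum_image (f := fun j => starCoeff T κ p * t ^ p / p.factorial *
        (a j * t ^ j / j.factorial)) (g := fun m => m - p)]
    · refine Finset.sum_le_sum_of_subset_of_nonneg ?_ fun j _ _ => hnn j
      intro j hj
      simp only [Finset.mem_image, Finset.mem_filter, Finset.mem_range] at hj ⊢
      omega
    · intro m hm m' hm' h
      simp only [Finset.coe_filter, Set.mem_ofPred_eq] at hm hm' h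
      omega
  have hS : ∀ t, HasDerivAt (fun t => T / κ ^ 2 * mgfExponent (κ * t)) (D t) t := by
    intro t
    have h := ((hasDerivAt_mgfExponent (κ * t)).comp t
      ((hasDerivAt_id t).const_mul κ)).const_mul (T / κ ^ 2)
    refine h.congr_deriv ?_
    simp only [hD]
    field_simp
  -- Grönwall: `D` is the derivative of the exponent, so `g` is nonincreasing on `t ≥ 0` and starts
  -- at `a 0 ≤ 1`.
  set g : ℝ → ℝ := fun t => P t * Real.exp (-(T / κ ^ 2 * mgfExponent (κ * t))) with hg
  have hgd : ∀ t, HasDerivAt g ((P' t - D t * P t) *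
      Real.exp (-(T / κ ^ 2 * mgfExponent (κ * t)))) t := by
    intro t
    refine ((hderiv t).mul ((hS t).neg.exp)).congr_deriv ?_
    simp only [Pi.neg_apply]
    ring
  have hanti : AntitoneOn g (Set.Ici 0) := by
    refine antitoneOn_of_deriv_nonpos (convex_Ici 0)
      (fun t _ => (hgd t).continuousAt.continuousWithinAt)
      (fun t _ => (hgd t).differentiableAt.differentiableWithinAt) ?_
    intro t ht
    rw [interior_Ici] at ht
    rw [(hgd t).deriv]
    exact mul_nonpos_of_nonpos_of_nonneg (by linarith [hbound t (le_of_lt ht)])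
      (Real.exp_pos _).le
  have h1 := hanti (Set.mem_Ici.2 le_rfl) (Set.mem_Ici.2 ht) ht
  have h0 : g 0 = a 0 := by
    simp [hg, hP, mgfExponent, Finset.sum_range_succ']
  rw [h0, hg] at h1
  simp only [Real.exp_neg] at h1
  rw [← div_eq_mul_inv] at h1
  have := (div_le_iff₀ (Real.exp_pos _)).1 (h1.trans ha0)
  linarith

end GeneratingFunction

end SpinLattice

namespace SpinLattice

open Matrix
open scoped MatrixOrder Matrix.Norms.L2Operator ComplexOrder

/-! ### Moments of a sum of centred observables. -/

section Moments

theorem sum_pow_eq_sum_list_prod {R W : Type*} [Semiring R] [Fintype W] (g : W → R) (m : ℕ) :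
    (∑ x, g x) ^ m = ∑ f : Fin m → W, (List.ofFn fun i => g (f i)).prod := by
  induction m with
  | zero => simp
  | succ m ih =>
    rw [pow_succ', ih, Finset.sum_mul_sum, ← Fintype.sum_prod_type']
    refine Fintype.sum_equiv (Fin.consEquiv fun _ => W) _ _ fun p => ?_
    simp [List.ofFn_succ, Fin.consEquiv]

variable {V : Type*} [Fintype V] [DecidableEq V] {q : ℕ}

theorem opNorm_nonneg (X : Op V q) : 0 ≤ opNorm X := norm_nonneg (E := Matrix _ _ ℂ) X

theorem opNorm_zero : opNorm (0 : Op V q) = 0 := norm_zero (E := Matrix _ _ ℂ)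

theorem opNorm_smul (c : ℂ) (X : Op V q) : opNorm (c • X) = ‖c‖ * opNorm X :=
  norm_smul (β := Matrix _ _ ℂ) c X

theorem opNorm_sub_le (X Y : Op V q) : opNorm (X - Y) ≤ opNorm X + opNorm Y :=
  norm_sub_le (E := Matrix _ _ ℂ) X Y

theorem opNorm_mul_le (X Y : Op V q) : opNorm (X * Y) ≤ opNorm X * opNorm Y :=
  norm_mul_le (α := Matrix _ _ ℂ) X Y

/-- `‖1‖ = ‖1‖²`; the value `0` is possible when the space is trivial. -/
theorem opNorm_one_le : opNorm (1 : Op V q) ≤ 1 := by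
  have h := CStarRing.norm_star_mul_self (x := (1 : Matrix (V → Fin q) (V → Fin q) ℂ))
  rw [star_one, one_mul] at h
  have h0 : ‖(1 : Matrix (V → Fin q) (V → Fin q) ℂ)‖ = opNorm (1 : Op V q) := rfl
  rw [h0] at h
  nlinarith [opNorm_nonneg (1 : Op V q)]

theorem opNorm_list_prod_le (l : List (Op V q)) : opNorm l.prod ≤ (l.map opNorm).prod := by
  induction l with
  | nil => simpa using opNorm_one_le
  | cons X l ih =>
    rw [List.prod_cons, List.map_cons, List.prod_cons]
    exact (opNorm_mul_le X l.prod).trans (mul_le_mul_of_nonneg_left ih (opNorm_nonneg X))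

variable [MetricSpace V]

/-- Two regions contain spins at distance at most `r`. -/
def Near (r : ℝ) (Λ Λ' : Finset V) : Prop := ∃ x ∈ Λ, ∃ y ∈ Λ', dist x y ≤ r

omit [Fintype V] [DecidableEq V] in
theorem Near.symm {r : ℝ} {Λ Λ' : Finset V} (h : Near r Λ Λ') : Near r Λ' Λ := by
  obtain ⟨x, hx, y, hy, hxy⟩ := h
  exact ⟨y, hy, x, hx, by rwa [dist_comm]⟩

/-- A family of observables of the regions with vanishing expectation values. -/
structure IsCentredFamily (σ : Op V q) (g : Finset V → Op V q) : Prop where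
  observable : ∀ Λ, IsObservableOn Λ (g Λ)
  expect_eq_zero : ∀ Λ, expect σ (g Λ) = 0
  empty : g ∅ = 0

variable {σ : Op V q} {ξ C r : ℝ} {g : Finset V → Op V q}

theorem norm_expect_list_prod_le (hσ : IsState σ) (hcor : HasCorrelationLength σ ξ C)
    (hξ : 0 < ξ) (hC : 0 < C) (hr : 0 < r) (hg : IsCentredFamily σ g) {m : ℕ}
    (f : Fin m → Finset V) :
    ‖expect σ (List.ofFn fun i => g (f i)).prod‖ ≤
      clusterWeight (Near r) (fun Λ => opNorm (g Λ)) f +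
        C * Real.exp (-(r / ξ)) * ∏ i, opNorm (g (f i)) := by
  have hprod0 : 0 ≤ ∏ i, opNorm (g (f i)) := Finset.prod_nonneg fun i _ => opNorm_nonneg _
  have hC0 : 0 ≤ C * Real.exp (-(r / ξ)) * ∏ i, opNorm (g (f i)) := by positivity
  have hnorm : ‖expect σ (List.ofFn fun i => g (f i)).prod‖ ≤ ∏ i, opNorm (g (f i)) := by
    refine (hσ.norm_expect_le _).trans ((opNorm_list_prod_le _).trans (le_of_eq ?_))
    rw [List.map_ofFn, List.prod_ofFn]
    rfl
  by_cases hiso : NoIsolated (Near r) f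
  · rw [clusterWeight, if_pos hiso]
    linarith
  rw [clusterWeight, if_neg hiso, zero_add]
  by_cases hemp : ∃ j, f j = ∅
  · obtain ⟨j, hj⟩ := hemp
    rw [Finset.prod_eq_zero (Finset.mem_univ j) (by rw [hj, hg.empty]; exact opNorm_zero)] at hnorm
    exact hnorm.trans hC0
  push Not at hemp
  unfold NoIsolated at hiso
  push Not at hiso
  obtain ⟨i, hi⟩ := hiso
  set L := List.ofFn fun i => g (f i) with hL
  have hlen : L.length = m := by simp [hL]
  have hiL : (i : ℕ) < L.length := by rw [hlen]; exact i.2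
  have hLi : L[(i : ℕ)] = g (f i) := by simp [hL]
  have hsplit : L = L.take i ++ g (f i) :: L.drop (i + 1) := by
    rw [← hLi, ← List.drop_eq_getElem_cons hiL, List.take_append_drop]
  -- All factors except the isolated one act on `U`, so the isolated factor can be moved to the far
  -- right.
  set U : Finset V := (Finset.univ.filter fun j => j ≠ i).biUnion f with hU
  have hact : ∀ j, j ≠ i → ActsOn U (g (f j)) := fun j hj =>
    (hg.observable (f j)).2.mono (Finset.subset_biUnion_of_mem f (by simp [hj]))
  have hA : ActsOn U (L.take i).prod := by
    refine ActsOn.list_prod fun X hX => ?_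
    obtain ⟨j, hj, rfl⟩ := List.mem_take_iff_getElem.1 hX
    have hjm : j < m := by omega
    have : L[j] = g (f ⟨j, hjm⟩) := by simp [hL]
    rw [this]
    exact hact _ (by simp only [ne_eq, Fin.ext_iff]; omega)
  have hB : ActsOn U (L.drop (i + 1)).prod := by
    refine ActsOn.list_prod fun X hX => ?_
    obtain ⟨j, hj, rfl⟩ := List.mem_drop_iff_getElem.1 hX
    have hjm : i + 1 + j < m := by omega
    have : L[(i : ℕ) + 1 + j] = g (f ⟨i + 1 + j, hjm⟩) := by simp [hL]
    rw [this]
    exact hact _ (by simp only [ne_eq, Fin.ext_iff]; omega)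
  have hdist : ∀ x ∈ U, ∀ y ∈ f i, r ≤ dist x y := by
    intro x hx y hy
    rw [hU, Finset.mem_biUnion] at hx
    obtain ⟨j, hj, hxj⟩ := hx
    by_contra! hlt
    exact hi j (by simpa using hj) ⟨y, hy, x, hxj, by rw [dist_comm]; exact hlt.le⟩
  have hdisj : Disjoint U (f i) := by
    refine Finset.disjoint_left.2 fun x hx1 hx2 => ?_
    have := hdist x hx1 x hx2
    rw [dist_self] at this
    linarith
  have hLprod : L.prod = (L.take i).prod * (L.drop (i + 1)).prod * g (f i) := by
    conv_lhs => rw [hsplit]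
    rw [List.prod_append, List.prod_cons, ← hB.commute hdisj (hg.observable _).2, mul_assoc]
  have hnn : opNorm ((L.take i).prod * (L.drop (i + 1)).prod) * opNorm (g (f i)) ≤
      ∏ i, opNorm (g (f i)) := by
    have h1 : ∏ i, opNorm (g (f i)) = (L.map opNorm).prod := by
      rw [hL, List.map_ofFn, List.prod_ofFn]
      rfl
    rw [h1]
    conv_rhs => rw [hsplit]
    rw [List.map_append, List.map_cons, List.prod_append, List.prod_cons]
    have h2 := opNorm_mul_le (L.take i).prod (L.drop (i + 1)).prod
    have h3 := opNorm_list_prod_le (L.take i)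
    have h4 := opNorm_list_prod_le (L.drop (i + 1))
    have h5 := mul_le_mul h3 h4 (opNorm_nonneg _) ((opNorm_nonneg _).trans h3)
    have h6 := mul_le_mul_of_nonneg_right (h2.trans h5) (opNorm_nonneg (g (f i)))
    refine h6.trans (le_of_eq ?_)
    ring
  rw [hLprod]
  by_cases hUe : U.Nonempty
  · refine (hcor.norm_expect_mul_le hσ hξ hC hr hUe (hemp i) hdist (hA.mul hB)
      (hg.observable _) (hg.expect_eq_zero _)).trans ?_
    rw [mul_right_comm]
    gcongr
  -- With no other region present the remaining product is a scalar, and centring makes the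
  -- expectation vanish.
  · rw [Finset.not_nonempty_iff_eq_empty] at hUe
    rw [hUe] at hA hB
    obtain ⟨c, hc⟩ := (hA.mul hB).eq_smul_one
    have h0 := hg.expect_eq_zero (f i)
    unfold expect at h0 ⊢
    rw [hc, Matrix.smul_mul, Matrix.mul_smul, Matrix.trace_smul, Matrix.one_mul, h0, smul_zero,
      norm_zero]
    exact hC0

theorem norm_expect_pow_le (hσ : IsState σ) (hcor : HasCorrelationLength σ ξ C)
    (hξ : 0 < ξ) (hC : 0 < C) (hr : 0 < r) (hg : IsCentredFamily σ g) (m : ℕ) :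
    ‖expect σ ((∑ Λ, g Λ) ^ m)‖ ≤
      clusterSum (Near r) (fun Λ => opNorm (g Λ)) (Fin m) +
        C * Real.exp (-(r / ξ)) * (∑ Λ, opNorm (g Λ)) ^ m := by
  have h : expect σ ((∑ Λ, g Λ) ^ m) =
      ∑ f : Fin m → Finset V, expect σ (List.ofFn fun i => g (f i)).prod := by
    unfold expect
    rw [sum_pow_eq_sum_list_prod, Matrix.mul_sum, Matrix.trace_sum]
  rw [h, Fintype.sum_pow, Finset.mul_sum, clusterSum, ← Finset.sum_add_distrib]
  exact norm_sum_le_of_le _ fun f _ => norm_expect_list_prod_le hσ hcor hξ hC hr hg f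

/-- The near tuples give the star generating function, the far ones the exponential series of `tn`.
-/
theorem sum_moments_le (hσ : IsState σ) (hcor : HasCorrelationLength σ ξ C)
    (hξ : 0 < ξ) (hC : 0 < C) (hr : 0 < r) (hg : IsCentredFamily σ g) {T κ n t : ℝ}
    (hκ0 : 0 < κ) (ht : 0 ≤ t)
    (hκ : ∀ Λ, opNorm (g Λ) ≠ 0 → weightedDegree (Near r) (fun Λ => opNorm (g Λ)) Λ ≤ κ)
    (hT : ∑ Λ, opNorm (g Λ) * weightedDegree (Near r) (fun Λ => opNorm (g Λ)) Λ ≤ T)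
    (hn : ∑ Λ, opNorm (g Λ) ≤ n) (N : ℕ) :
    ∑ m ∈ Finset.range N, t ^ m / m.factorial * (σ * (∑ Λ, g Λ) ^ m).trace.re ≤
      Real.exp (T / κ ^ 2 * mgfExponent (κ * t)) + C * Real.exp (t * n - r / ξ) := by
  have hw : ∀ Λ, 0 ≤ opNorm (g Λ) := fun Λ => opNorm_nonneg _
  have hT0 : 0 ≤ T := le_trans (Finset.sum_nonneg fun x _ =>
    mul_nonneg (hw x) (weightedDegree_nonneg hw x)) hT
  have hn0 : 0 ≤ n := (Finset.sum_nonneg fun Λ _ => hw Λ).trans hn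
  have h1 := sum_le_exp_mgfExponent hT0 hκ0
    (a := fun m => clusterSum (Near r) (fun Λ => opNorm (g Λ)) (Fin m))
    (fun m => clusterSum_nonneg hw _) (by simp [clusterSum, clusterWeight, NoIsolated])
    (clusterSum_succ_le (fun _ _ => Near.symm) hw hκ hT hκ0.le) ht N
  have h2 := Real.sum_le_exp_of_nonneg (mul_nonneg ht hn0) N
  have h3 : C * Real.exp (-(r / ξ)) * ∑ m ∈ Finset.range N, (t * n) ^ m / m.factorial ≤
      C * Real.exp (t * n - r / ξ) := by
    rw [sub_eq_neg_add, Real.exp_add, ← mul_assoc]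
    gcongr
  refine le_trans ?_ (add_le_add h1 h3)
  rw [Finset.mul_sum, ← Finset.sum_add_distrib]
  refine Finset.sum_le_sum fun m _ => ?_
  have h4 : (σ * (∑ Λ, g Λ) ^ m).trace.re ≤
      clusterSum (Near r) (fun Λ => opNorm (g Λ)) (Fin m) +
        C * Real.exp (-(r / ξ)) * n ^ m := by
    refine (Complex.re_le_norm _).trans
      ((norm_expect_pow_le hσ hcor hξ hC hr hg m).trans ?_)
    have := Finset.sum_nonneg fun Λ (_ : Λ ∈ Finset.univ) => hw Λ
    gcongr
  refine (mul_le_mul_of_nonneg_left h4 (by positivity)).trans (le_of_eq ?_)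
  rw [mul_pow]
  ring

end Moments

/-! ### Weighted degrees of the nearness graph. -/

section Degrees

variable {V : Type*} [Fintype V] [DecidableEq V] [MetricSpace V] {w : Finset V → ℝ} {r K : ℝ}

/-- A region near `Λ` contains a point of a ball around some `x ∈ Λ`: there are `|Λ|` centres, at
most `K` points in each ball, and weight at most `1` through each point. -/
theorem weightedDegree_near_le (hw : ∀ Λ, 0 ≤ w Λ)
    (hx : ∀ x : V, ∑ Λ : Finset V with x ∈ Λ, w Λ ≤ 1)
    (hball : ∀ v : V, ((Metric.closedBall v r).ncard : ℝ) ≤ K) (Λ : Finset V) :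
    weightedDegree (Near r) w Λ ≤ Λ.card * K := by
  classical
  have h1 : ∀ Λ', (if Near r Λ Λ' then w Λ' else 0) ≤
      ∑ x ∈ Λ, ∑ y : V with y ∈ Metric.closedBall x r, if y ∈ Λ' then w Λ' else 0 := by
    intro Λ'
    have hnn : ∀ y, 0 ≤ if y ∈ Λ' then w Λ' else 0 := fun y => by
      split_ifs
      · exact hw _
      · exact le_rfl
    split_ifs with hnear
    · obtain ⟨x, hx, y, hy, hxy⟩ := hnear
      refine le_trans ?_ (Finset.single_le_sum
        (fun x _ => Finset.sum_nonneg fun y _ => hnn y) hx)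
      refine le_trans ?_ (Finset.single_le_sum (fun y _ => hnn y)
        (Finset.mem_filter.2 ⟨Finset.mem_univ y, by
          rw [Metric.mem_closedBall, dist_comm]; exact hxy⟩))
      rw [if_pos hy]
    · exact Finset.sum_nonneg fun x _ => Finset.sum_nonneg fun y _ => hnn y
  unfold weightedDegree
  refine (Finset.sum_le_sum fun Λ' _ => h1 Λ').trans ?_
  rw [Finset.sum_comm, ← nsmul_eq_mul]
  refine Finset.sum_le_card_nsmul _ _ _ fun x _ => ?_
  rw [Finset.sum_comm]
  refine le_trans ?_ (hball x)
  rw [Set.ncard_eq_toFinset_card', ← nsmul_one]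
  have h2 : (Metric.closedBall x r).toFinset =
      Finset.univ.filter fun y => y ∈ Metric.closedBall x r := by
    ext y; simp
  rw [h2]
  refine Finset.sum_le_card_nsmul _ _ _ fun y _ => ?_
  rw [← Finset.sum_filter]
  exact hx y

omit [MetricSpace V] in
theorem sum_mul_card_le (hx : ∀ x : V, ∑ Λ : Finset V with x ∈ Λ, w Λ ≤ 1) :
    ∑ Λ : Finset V, w Λ * Λ.card ≤ Fintype.card V := by
  have h : ∑ Λ : Finset V, w Λ * Λ.card = ∑ x : V, ∑ Λ : Finset V with x ∈ Λ, w Λ := by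
    simp only [Finset.sum_filter]
    rw [Finset.sum_comm]
    refine Finset.sum_congr rfl fun Λ _ => ?_
    rw [← Finset.sum_filter, Finset.filter_mem_eq_inter, Finset.univ_inter, Finset.sum_const,
      nsmul_eq_mul, mul_comm]
  rw [h, ← nsmul_one, ← Finset.card_univ]
  exact Finset.sum_le_card_nsmul _ _ _ fun x _ => hx x

end Degrees

end SpinLattice

namespace SpinLattice

open Matrix
open scoped MatrixOrder Matrix.Norms.L2Operator ComplexOrder

/-! ### Centred decompositions and the entropic bound at fixed radius. -/

section Decompositions

variable {V : Type*} [Fintype V] [DecidableEq V] {q k : ℕ}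

/-- The observable minus its expectation value. -/
noncomputable def centred (σ X : Op V q) : Op V q := X - expect σ X • 1

theorem expect_centred {σ : Op V q} (hσ : IsState σ) (X : Op V q) :
    expect σ (centred σ X) = 0 := by
  unfold centred expect
  rw [Matrix.mul_sub, Matrix.trace_sub, Matrix.mul_smul, Matrix.trace_smul, Matrix.mul_one, hσ.2]
  simp

theorem isHermitian_centred {σ : Op V q} (hσ : IsState σ) {X : Op V q} (hX : X.IsHermitian) :
    (centred σ X).IsHermitian := by
  unfold centred
  rw [hσ.expect_eq_re hX, Matrix.IsHermitian, Matrix.conjTranspose_sub,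
    Matrix.conjTranspose_smul, hX.eq, Matrix.conjTranspose_one]
  simp

theorem actsOn_centred (σ : Op V q) {Λ : Finset V} {X : Op V q} (hX : ActsOn Λ X) :
    ActsOn Λ (centred σ X) := by
  have h := hX.add ((actsOn_one Λ).smul (-expect σ X))
  rwa [neg_smul, ← sub_eq_add_neg] at h

/-- The factor lost here is the `2` in the definition of the local norm. -/
theorem opNorm_centred_le {σ : Op V q} (hσ : IsState σ) (X : Op V q) :
    opNorm (centred σ X) ≤ 2 * opNorm X := by
  have h1 := opNorm_sub_le X (expect σ X • 1)
  rw [opNorm_smul] at h1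
  have h2 := mul_le_mul (hσ.norm_expect_le X) (opNorm_one_le (V := V) (q := q))
    (opNorm_nonneg _) (opNorm_nonneg _)
  unfold centred
  linarith

theorem sum_centred {α : Type*} (s : Finset α) (σ : Op V q) (h : α → Op V q) :
    ∑ a ∈ s, centred σ (h a) = centred σ (∑ a ∈ s, h a) := by
  unfold centred expect
  rw [Finset.sum_sub_distrib, Matrix.mul_sum, Matrix.trace_sum, Finset.sum_smul]

theorem IsDecomposition.isCentredFamily {σ : Op V q} (hσ : IsState σ) {H : Op V q}
    {h : Finset V → Op V q} (hh : IsDecomposition k H h) :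
    IsCentredFamily σ fun Λ => centred σ (h Λ) where
  observable Λ := ⟨isHermitian_centred hσ (hh.1 Λ).1, actsOn_centred σ (hh.1 Λ).2⟩
  expect_eq_zero Λ := expect_centred hσ _
  empty := by
    obtain ⟨c, hc⟩ := (hh.1 ∅).2.eq_smul_one
    unfold centred expect
    rw [hc, Matrix.mul_smul, Matrix.trace_smul, Matrix.mul_one, hσ.2]
    simp

theorem IsDecomposition.smul {H : Op V q} {h : Finset V → Op V q} (hh : IsDecomposition k H h)
    (c : ℝ) : IsDecomposition k ((c : ℂ) • H) fun Λ => (c : ℂ) • h Λ := by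
  refine ⟨fun Λ => ⟨?_, (hh.1 Λ).2.smul _⟩, fun Λ hΛ => by simp [hh.2.1 Λ hΛ], ?_⟩
  · rw [Matrix.IsHermitian, Matrix.conjTranspose_smul, (hh.1 Λ).1.eq]
    simp
  · rw [← Finset.smul_sum, ← hh.2.2]

theorem IsKLocal.exists_isDecomposition {H : Op V q} (hH : H.IsHermitian) (hk : IsKLocal k H) :
    ∃ h, IsDecomposition k H h := by
  obtain ⟨Y, hY, hY0, hsum⟩ := hk
  refine ⟨fun Λ => hermPart (Y Λ), fun Λ => ⟨hermPart_isHermitian _,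
    ((hY Λ).add (hY Λ).conjTranspose).smul _⟩, fun Λ hΛ => by simp [hermPart, hY0 Λ hΛ], ?_⟩
  unfold hermPart
  rw [← Finset.smul_sum, Finset.sum_add_distrib, ← Matrix.conjTranspose_sum, ← hsum, hH.eq,
    ← two_smul ℂ H, smul_smul]
  norm_num

/-- Below the local `W₁` norm there are values of observables with a decomposition of norm at
most one. -/
theorem exists_isDecomposition_of_lt_localW1Norm {Δ : Op V q} {c : ℝ} (hc : 0 < c)
    (hcΔ : c < localW1Norm k Δ) :
    ∃ H h, IsDecomposition k H h ∧ (∀ x : V, ∑ Λ : Finset V with x ∈ Λ, opNorm (h Λ) ≤ 1 / 2) ∧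
      (Δ * H).trace.re = c := by
  unfold localW1Norm at hcΔ
  have hne : {c : ℝ | ∃ H : Op V q, H.IsHermitian ∧ IsKLocal k H ∧ localNorm k H ≤ 1 ∧
      c = (Δ * H).trace.re}.Nonempty := by
    by_contra hcon
    rw [Set.not_nonempty_iff_eq_empty] at hcon
    rw [hcon, Real.sSup_empty] at hcΔ
    linarith
  obtain ⟨c', ⟨H, hH, hkH, hloc, rfl⟩, hlt⟩ := exists_lt_of_lt_csSup hne hcΔ
  set c' := (Δ * H).trace.re with hc'
  obtain ⟨h₀, hh₀⟩ := hkH.exists_isDecomposition hH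
  have hc'0 : 0 < c' := hc.trans hlt
  -- No optimal decomposition is needed: the slack between `c` and `c'` lets one exceed the infimum
  -- slightly, and rescaling by `c / c'` restores the bound `1/2` while giving exactly the value
  -- `c`.
  have hone : 1 < c' / c := by rwa [one_lt_div hc]
  unfold localNorm at hloc
  obtain ⟨b, ⟨h, hh, hb⟩, hblt⟩ := exists_lt_of_csInf_lt (b := c' / c / 2)
    (s := {c : ℝ | ∃ h : Finset V → Op V q, IsDecomposition k H h ∧
      c = ⨆ x : V, ∑ Λ ∈ Finset.univ.filter (fun Λ : Finset V => x ∈ Λ), opNorm (h Λ)})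
    ⟨_, h₀, hh₀, rfl⟩ (by linarith)
  refine ⟨((c / c' : ℝ) : ℂ) • H, fun Λ => ((c / c' : ℝ) : ℂ) • h Λ, hh.smul _, fun x => ?_, ?_⟩
  · have h1 : ∑ Λ : Finset V with x ∈ Λ, opNorm (h Λ) ≤ b := by
      rw [hb]
      exact le_ciSup (f := fun x : V => ∑ Λ : Finset V with x ∈ Λ, opNorm (h Λ))
        (Set.finite_range _).bddAbove x
    have h2 : 0 < c / c' := by positivity
    simp only [opNorm_smul, Complex.norm_real, Real.norm_eq_abs, abs_of_pos h2]
    rw [← Finset.mul_sum]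
    have h3 := mul_le_mul_of_nonneg_left (h1.trans hblt.le) h2.le
    refine h3.trans (le_of_eq ?_)
    field_simp
  · rw [Matrix.mul_smul, Matrix.trace_smul, smul_eq_mul, Complex.re_ofReal_mul, ← hc']
    field_simp

variable [MetricSpace V]

/-- The entropic bound from an observable with a decomposition of local norm at most one. -/
theorem IsDecomposition.le_measuredRelEntropy [Nonempty V] (hk : 1 ≤ k) {ρ σ : Op V q}
    (hρ : IsState ρ) (hσ : IsState σ) {ξ C r K t : ℝ} (hcor : HasCorrelationLength σ ξ C)
    (hξ : 0 < ξ) (hC : 0 < C) (hr : 0 < r) (hK : 0 < K) (ht : 0 ≤ t)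
    (hball : ∀ v : V, ((Metric.closedBall v r).ncard : ℝ) ≤ K) {H : Op V q}
    {h : Finset V → Op V q} (hh : IsDecomposition k H h)
    (hx : ∀ x : V, ∑ Λ : Finset V with x ∈ Λ, opNorm (h Λ) ≤ 1 / 2) :
    ((t * ((ρ - σ) * H).trace.re - Real.log
      (Real.exp (Fintype.card V / (k ^ 2 * K) * mgfExponent (k * K * t)) +
        C * Real.exp (t * Fintype.card V - r / ξ)) : ℝ) : EReal) ≤ measuredRelEntropy ρ σ := by
  have hk' : (0 : ℝ) < k := by exact_mod_cast hk
  have hg := hh.isCentredFamily hσ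
  set g : Finset V → Op V q := fun Λ => centred σ (h Λ) with hg_def
  have hGsum : ∑ Λ, g Λ = centred σ H := by rw [hg_def, sum_centred, ← hh.2.2]
  have hw : ∀ Λ, 0 ≤ opNorm (g Λ) := fun Λ => opNorm_nonneg _
  have hx' : ∀ x : V, ∑ Λ : Finset V with x ∈ Λ, opNorm (g Λ) ≤ 1 := by
    intro x
    refine (Finset.sum_le_sum fun Λ _ => opNorm_centred_le hσ (h Λ)).trans ?_
    rw [← Finset.mul_sum]
    linarith [hx x]
  have hcard := sum_mul_card_le hx'
  have hdeg := weightedDegree_near_le hw hx' hball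
  have hκ : ∀ Λ, opNorm (g Λ) ≠ 0 →
      weightedDegree (Near r) (fun Λ => opNorm (g Λ)) Λ ≤ k * K := by
    intro Λ hΛ
    refine (hdeg Λ).trans (mul_le_mul_of_nonneg_right ?_ hK.le)
    by_contra! hlt
    refine hΛ ?_
    have : h Λ = 0 := hh.2.1 Λ (by exact_mod_cast hlt)
    simp [hg_def, this, centred, expect, opNorm_zero]
  -- Keeping `|Λ|` rather than `k` in the degree bound and double counting avoids a factor `k` in
  -- `T`.
  have hT : ∑ Λ, opNorm (g Λ) * weightedDegree (Near r) (fun Λ => opNorm (g Λ)) Λ ≤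
      Fintype.card V * K := by
    refine le_trans (Finset.sum_le_sum fun Λ _ => mul_le_mul_of_nonneg_left (hdeg Λ) (hw Λ)) ?_
    simp only [← mul_assoc]
    rw [← Finset.sum_mul]
    exact mul_le_mul_of_nonneg_right hcard hK.le
  have hn : ∑ Λ, opNorm (g Λ) ≤ Fintype.card V := by
    refine le_trans (Finset.sum_le_sum fun Λ _ => ?_) hcard
    rcases Λ.eq_empty_or_nonempty with rfl | hΛ
    · rw [hg.empty, opNorm_zero, zero_mul]
    · exact le_mul_of_one_le_right (hw Λ) (by exact_mod_cast hΛ.card_pos)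
  have hmom := sum_moments_le hσ hcor hξ hC hr hg (mul_pos hk' hK) ht hκ hT hn
  rw [hGsum] at hmom
  have hHerm : H.IsHermitian := by
    rw [hh.2.2, Matrix.IsHermitian, Matrix.conjTranspose_sum]
    exact Finset.sum_congr rfl fun Λ _ => (hh.1 Λ).1
  have hmain := SpinLattice.le_measuredRelEntropy hρ hσ (isHermitian_centred hσ hHerm) hmom
  have e1 : (ρ * centred σ H).trace.re = ((ρ - σ) * H).trace.re := by
    unfold centred
    rw [Matrix.mul_sub, Matrix.trace_sub, Matrix.mul_smul, Matrix.trace_smul, Matrix.mul_one,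
      hρ.2, Matrix.sub_mul, Matrix.trace_sub, expect]
    simp
  have e2 : (Fintype.card V * K / (k * K) ^ 2 : ℝ) = Fintype.card V / (k ^ 2 * K) := by
    field_simp
  rwa [e1, e2] at hmain

end Decompositions

/-! ### Choice of the radius and of the parameter. -/

section TransportationCost

/-- `mgfExponent s / s` is nondecreasing. This allows an exponent evaluated at `s / K` to be traded
for one at `s`. -/
theorem mul_mgfExponent_le {K s : ℝ} (hK : 1 ≤ K) (hs : 0 ≤ s) :
    K * mgfExponent s ≤ mgfExponent (K * s) := by
  have hmono : MonotoneOn (fun s : ℝ => Real.exp s - 1 - s / 2) (Set.Ici 0) := by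
    refine monotoneOn_of_deriv_nonneg (convex_Ici 0) (by fun_prop) (by fun_prop) ?_
    intro x hx
    rw [interior_Ici] at hx
    have h := ((Real.hasDerivAt_exp x).sub_const 1).sub ((hasDerivAt_id x).div_const 2)
    have h' : deriv (fun s : ℝ => Real.exp s - 1 - s / 2) x = Real.exp x - 1 / 2 := h.deriv
    rw [h']
    linarith [Real.one_le_exp (le_of_lt hx)]
  have h1 : s ≤ K * s := le_mul_of_one_le_left hs hK
  have h2 := mul_le_mul_of_nonneg_left
    (hmono (Set.mem_Ici.2 hs) (Set.mem_Ici.2 (hs.trans h1)) h1)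
    (show 0 ≤ K * s by positivity)
  unfold mgfExponent
  linarith

theorem mgfExponent_nonneg {s : ℝ} (hs : 0 ≤ s) : 0 ≤ mgfExponent s :=
  mul_nonneg hs (by linarith [Real.add_one_le_exp s])

/-- Passes to the limit `c → W`, since test observables are only available for values strictly below
the `W₁` norm. -/
theorem coe_mul_sub_le_of_forall_lt {S : EReal} (hS : 0 ≤ S) {t B W : ℝ} (hW : 0 < W)
    (h : ∀ c : ℝ, 0 < c → c < W → ((t * c - B : ℝ) : EReal) ≤ S) :
    ((t * W - B : ℝ) : EReal) ≤ S := by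
  induction S with
  | bot => exact absurd hS (by simp)
  | top => exact le_top
  | coe a =>
    rw [EReal.coe_le_coe_iff]
    have hc : Filter.Tendsto (fun c : ℝ => t * c - B) (nhdsWithin W (Set.Iio W))
        (nhds (t * W - B)) :=
      (Continuous.tendsto (by fun_prop) W).mono_left nhdsWithin_le_nhds
    refine le_of_tendsto hc ?_
    filter_upwards [self_mem_nhdsWithin, nhdsWithin_le_nhds (lt_mem_nhds hW)] with c hc1 hc2
    exact EReal.coe_le_coe_iff.1 (h c hc2 hc1)

variable {k : ℕ} {d A ξ n w : ℝ}

/-- The radius `(n b(w))^(1 / (2 d + 1))`. -/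
noncomputable def costRadius (k : ℕ) (d A ξ n w : ℝ) : ℝ :=
  (n * bracket k A ξ w) ^ (1 / (2 * d + 1))

theorem costRadius_pos (hk : 1 ≤ k) (hA : 0 < A) (hξ : 0 < ξ) (hn : 0 < n) (hw : 0 < w) :
    0 < costRadius k d A ξ n w :=
  Real.rpow_pos_of_pos (mul_pos hn (bracket_pos hk hA hξ hw)) _

theorem costRadius_rpow (hk : 1 ≤ k) (hd : 1 ≤ d) (hA : 0 < A) (hξ : 0 < ξ) (hn : 0 < n)
    (hw : 0 < w) : costRadius k d A ξ n w ^ (2 * d + 1) = n * bracket k A ξ w := by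
  have h := mul_pos hn (bracket_pos hk hA hξ hw)
  unfold costRadius
  rw [← Real.rpow_mul h.le, one_div, inv_mul_cancel₀ (by linarith), Real.rpow_one]

/-- The balance that defines the radius: it makes `r/ξ` dominate `tn` for the later choice of `t`.
-/
theorem costRadius_div (hk : 1 ≤ k) (hd : 1 ≤ d) (hA : 0 < A) (hξ : 0 < ξ) (hn : 0 < n)
    (hw : 0 < w) {K : ℝ} (hK : K = A * costRadius k d A ξ n w ^ d) :
    costRadius k d A ξ n w / ξ =
      n * (k * sStar (k * w) + rateF (k * w)) / (k * K ^ 2) := by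
  have hk' : (0 : ℝ) < k := by exact_mod_cast hk
  have h1 := costRadius_rpow hk hd hA hξ hn hw
  have hr := costRadius_pos (d := d) hk hA hξ hn hw
  set r := costRadius k d A ξ n w
  have hrd : 0 < r ^ d := Real.rpow_pos_of_pos hr d
  have h2 : r ^ (2 * d + 1) = (r ^ d) ^ 2 * r := by
    rw [Real.rpow_add hr, Real.rpow_one, mul_comm 2 d, Real.rpow_mul hr.le, Real.rpow_two]
  rw [h2, bracket] at h1
  rw [hK]
  field_simp at h1 ⊢
  linarith

theorem rpow_mul_costF (hk : 1 ≤ k) (hd : 1 ≤ d) (hA : 0 < A) (hξ : 0 < ξ) (hn : 0 < n)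
    (hw : 0 < w) {K : ℝ} (hK : K = A * costRadius k d A ξ n w ^ d) :
    n ^ (1 / (2 * d + 1)) * costF k d A ξ w = n * rateF (k * w) / (k * K) ^ 2 := by
  have hk' : (0 : ℝ) < k := by exact_mod_cast hk
  have hb := bracket_pos hk hA hξ hw
  have h1 : (costRadius k d A ξ n w ^ d) ^ 2 =
      n ^ (2 * d / (2 * d + 1)) * bracket k A ξ w ^ (2 * d / (2 * d + 1)) := by
    unfold costRadius
    rw [← Real.rpow_two, ← Real.rpow_mul (by positivity), ← Real.rpow_mul (by positivity),
      ← Real.mul_rpow hn.le hb.le]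
    congr 1
    ring
  have h2 : n = n ^ (1 / (2 * d + 1)) * n ^ (2 * d / (2 * d + 1)) := by
    rw [← Real.rpow_add hn, ← add_div, add_comm, div_self (by linarith), Real.rpow_one]
  have h3 : 0 < n ^ (2 * d / (2 * d + 1)) := Real.rpow_pos_of_pos hn _
  have h4 : 0 < bracket k A ξ w ^ (2 * d / (2 * d + 1)) := Real.rpow_pos_of_pos hb _
  have h5 : (k * K) ^ 2 = k ^ 2 * A ^ 2 *
      (n ^ (2 * d / (2 * d + 1)) * bracket k A ξ w ^ (2 * d / (2 * d + 1))) := by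
    rw [← h1, hK]; ring
  rw [h5, costF]
  nth_rewrite 2 [h2]
  field_simp

/-- The summand `F` in `b(w)` is what puts the main term below `r/(kξ)`; this settles the case of a
radius smaller than `r₀`. -/
theorem rpow_mul_costF_le (hk : 1 ≤ k) (hd : 1 ≤ d) (hA : 0 < A) (hξ : 0 < ξ) (hn : 0 < n)
    (hw : 0 < w) : n ^ (1 / (2 * d + 1)) * costF k d A ξ w ≤
      costRadius k d A ξ n w / (k * ξ) := by
  have hk' : (0 : ℝ) < k := by exact_mod_cast hk
  have hr := costRadius_pos (d := d) hk hA hξ hn hw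
  have hs := sStar_nonneg (k * w)
  have hrd : 0 < costRadius k d A ξ n w ^ d := Real.rpow_pos_of_pos hr d
  rw [rpow_mul_costF hk hd hA hξ hn hw rfl, mul_comm (k : ℝ) ξ, ← div_div,
    costRadius_div hk hd hA hξ hn hw rfl, div_div, mul_pow]
  have e : (k : ℝ) * (A * costRadius k d A ξ n w ^ d) ^ 2 * k =
      k ^ 2 * (A * costRadius k d A ξ n w ^ d) ^ 2 := by ring
  rw [e]
  gcongr
  nlinarith

variable {V : Type*} [Fintype V] [DecidableEq V] [Nonempty V] [MetricSpace V] {q : ℕ}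

theorem transportationCost_of_le {r₀ C : ℝ} (hk : 1 ≤ k) (hd : 1 ≤ d) (hA : 0 < A)
    (hξ : 0 < ξ) (hC : 0 < C)
    (hball : ∀ (v : V) (r : ℝ), r₀ ≤ r → ((Metric.closedBall v r).ncard : ℝ) ≤ A * r ^ d)
    {ρ σ : Op V q} (hρ : IsState ρ) (hσ : IsState σ) (hcor : HasCorrelationLength σ ξ C)
    (hw : 0 < w) (hn : n = Fintype.card V) (hwn : w * n = localW1Norm k (ρ - σ))
    (hr : r₀ ≤ costRadius k d A ξ n w) :
    ((n ^ (1 / (2 * d + 1)) * costF k d A ξ w - Real.log (C + 1) : ℝ) : EReal) ≤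
      measuredRelEntropy ρ σ := by
  have hk' : (0 : ℝ) < k := by exact_mod_cast hk
  have hn0 : 0 < n := by rw [hn]; exact_mod_cast Fintype.card_pos
  have hrpos := costRadius_pos (d := d) hk hA hξ hn0 hw
  have hrdiv := costRadius_div hk hd hA hξ hn0 hw rfl
  have hcost := rpow_mul_costF hk hd hA hξ hn0 hw rfl
  set r := costRadius k d A ξ n w
  set K := A * r ^ d with hK
  set s := sStar (k * w) with hs
  have hs0 : 0 ≤ s := sStar_nonneg _
  -- A ball contains its centre.
  have hK1 : 1 ≤ K := by
    obtain ⟨v⟩ := ‹Nonempty V›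
    refine le_trans ?_ (hball v r hr)
    have : 0 < (Metric.closedBall v r).ncard :=
      (Set.ncard_pos (Set.toFinite _)).2 ⟨v, Metric.mem_closedBall_self hrpos.le⟩
    exact_mod_cast this
  have hK0 : 0 < K := by linarith
  have hF : rateF (k * w) = s * (k * w - Real.exp s + 1 + s / 2) := by
    rw [rateF_eq, rateObj]
  have hFpos := rateF_pos (mul_pos hk' hw)
  -- With this choice `κt = s/K`, and after the scaling inequality both terms carry the factor
  -- `n/(kK)²`, leaving the objective maximized by `s`.
  set t := s / (k * K ^ 2) with ht
  have ht0 : 0 ≤ t := by positivity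
  set B := n / (k * K) ^ 2 * mgfExponent s with hB
  have hB0 : 0 ≤ B := mul_nonneg (by positivity) (mgfExponent_nonneg hs0)
  have hexp1 : n / (k ^ 2 * K) * mgfExponent (k * K * t) ≤ B := by
    have e1 : k * K * t = s / K := by rw [ht]; field_simp
    have h1 := mul_mgfExponent_le hK1 (show 0 ≤ s / K by positivity)
    rw [mul_div_cancel₀ _ hK0.ne'] at h1
    have h2 := mul_le_mul_of_nonneg_left h1 (show 0 ≤ n / (k * K) ^ 2 by positivity)
    rw [e1]
    refine le_trans (le_of_eq ?_) h2
    field_simp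
  have hexp2 : t * n - r / ξ ≤ 0 := by
    rw [hrdiv, ht]
    have e1 : s / (k * K ^ 2) * n - n * (k * s + rateF (k * w)) / (k * K ^ 2) =
        -(n * ((k - 1) * s + rateF (k * w)) / (k * K ^ 2)) := by
      field_simp
      ring
    have hk1 : (1 : ℝ) ≤ k := by exact_mod_cast hk
    have : 0 ≤ (k - 1) * s := mul_nonneg (by linarith) hs0
    rw [e1, neg_nonpos]
    positivity
  -- Since `B ≥ 0`, `e^B + C ≤ (C + 1) e^B`.
  have hlog : Real.log (Real.exp (n / (k ^ 2 * K) * mgfExponent (k * K * t)) +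
      C * Real.exp (t * n - r / ξ)) ≤ B + Real.log (C + 1) := by
    have h1 := Real.exp_le_exp.2 hexp1
    have h2 := Real.exp_le_one_iff.2 hexp2
    have h3 := Real.one_le_exp hB0
    rw [← Real.log_exp B, ← Real.log_mul (Real.exp_pos B).ne' (by positivity)]
    refine Real.log_le_log (by positivity) ?_
    nlinarith
  have hfinal : ∀ c : ℝ, 0 < c → c < localW1Norm k (ρ - σ) →
      ((t * c - (B + Real.log (C + 1)) : ℝ) : EReal) ≤ measuredRelEntropy ρ σ := by
    intro c hc hcW
    obtain ⟨H, h, hh, hx, hHc⟩ := exists_isDecomposition_of_lt_localW1Norm hc hcW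
    have h1 := hh.le_measuredRelEntropy hk hρ hσ hcor hξ hC hrpos hK0 ht0
      (fun v => hball v r hr) hx
    rw [hHc, ← hn] at h1
    refine le_trans ?_ h1
    rw [EReal.coe_le_coe_iff]
    linarith
  have h := coe_mul_sub_le_of_forall_lt (measuredRelEntropy_nonneg hρ hσ)
    (hwn ▸ mul_pos hw hn0) hfinal
  refine le_trans (le_of_eq ?_) h
  congr 1
  rw [hcost, hF, ← hwn, hB, ht, mgfExponent]
  field_simp
  ring

omit [MetricSpace V] in
theorem localW1Norm_nonneg (k : ℕ) (Δ : Op V q) : 0 ≤ localW1Norm k Δ := by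
  by_contra! hlt
  unfold localW1Norm at hlt
  -- The value `0` at `H = 0` suffices even without a boundedness proof, as an unbounded set has
  -- supremum `0` by convention.
  refine absurd hlt (not_lt.2 (Real.sSup_nonneg' ⟨0, ⟨0, Matrix.isHermitian_zero, ?_, ?_, ?_⟩,
    le_rfl⟩))
  · exact ⟨fun _ => 0, fun Λ => actsOn_zero Λ, fun _ _ => rfl, by simp⟩
  · unfold localNorm
    have : sInf {c : ℝ | ∃ h : Finset V → Op V q, IsDecomposition k 0 h ∧
        c = ⨆ x : V, ∑ Λ ∈ Finset.univ.filter (fun Λ : Finset V => x ∈ Λ), opNorm (h Λ)} ≤ 0 := by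
      refine csInf_le ⟨0, ?_⟩ ⟨fun _ => 0, ⟨fun Λ => ⟨Matrix.isHermitian_zero, actsOn_zero Λ⟩,
        fun _ _ => rfl, by simp⟩, by simp [opNorm_zero]⟩
      rintro _ ⟨h, _, rfl⟩
      exact Real.iSup_nonneg fun x => Finset.sum_nonneg fun Λ _ => opNorm_nonneg _
    linarith
  · simp

end TransportationCost

end SpinLattice

/-! ### The transportation-cost inequality. -/

theorem mainTheorem5 {V : Type*} [Fintype V] [DecidableEq V] [Nonempty V] [MetricSpace V]
    (q k : ℕ) (hk : 1 ≤ k)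
    (d A r₀ ξ C : ℝ) (hd : 1 ≤ d) (hA : 0 < A) (hr₀ : 0 < r₀) (hξ : 0 < ξ) (hC : 0 < C)
    (hball : ∀ (v : V) (r : ℝ), r₀ ≤ r → ((Metric.closedBall v r).ncard : ℝ) ≤ A * r ^ d) :
    StrictMonoOn (SpinLattice.costF k d A ξ) (Set.Ici 0) ∧
    ∀ ρ σ : SpinLattice.Op V q, SpinLattice.IsState ρ → SpinLattice.IsState σ →
      SpinLattice.HasCorrelationLength σ ξ C →
      ∀ n w : ℝ, n = Fintype.card V → w = SpinLattice.localW1Norm k (ρ - σ) / n →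
        (r₀ ^ (2 * d + 1) ≤ n * SpinLattice.bracket k A ξ w →
          ((n ^ (1 / (2 * d + 1)) * SpinLattice.costF k d A ξ w - Real.log (C + 1) : ℝ) : EReal)
            ≤ SpinLattice.measuredRelEntropy ρ σ) ∧
        ((n ^ (1 / (2 * d + 1)) * SpinLattice.costF k d A ξ w
            - max (Real.log (C + 1)) (r₀ / (k * ξ)) : ℝ) : EReal)
          ≤ SpinLattice.measuredRelEntropy ρ σ := by
  refine ⟨SpinLattice.costF_strictMonoOn hk hd hA hξ, ?_⟩
  intro ρ σ hρ hσ hcor n w hn hw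
  have hk' : (0 : ℝ) < k := by exact_mod_cast hk
  have hn0 : 0 < n := by rw [hn]; exact_mod_cast Fintype.card_pos
  have hw0 : 0 ≤ w := by
    rw [hw]; exact div_nonneg (SpinLattice.localW1Norm_nonneg k _) hn0.le
  have hS := SpinLattice.measuredRelEntropy_nonneg hρ hσ
  have hlog : 0 < Real.log (C + 1) := Real.log_pos (by linarith)
  rcases hw0.eq_or_lt with hw0 | hw0
  · rw [← hw0, SpinLattice.bracket_zero, SpinLattice.costF_zero]
    have hpow : 0 < r₀ ^ (2 * d + 1) := Real.rpow_pos_of_pos hr₀ _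
    -- For `w = 0` the size condition would read `r₀^(2d+1) ≤ 0`.
    refine ⟨fun h => absurd h (by simpa using hpow), le_trans ?_ hS⟩
    have h : n ^ (1 / (2 * d + 1)) * 0 - max (Real.log (C + 1)) (r₀ / (k * ξ)) ≤ 0 := by
      linarith [le_max_left (Real.log (C + 1)) (r₀ / (k * ξ))]
    exact_mod_cast h
  · have hwn : w * n = SpinLattice.localW1Norm k (ρ - σ) := by
      rw [hw]; field_simp
    have hr := SpinLattice.costRadius_pos (d := d) hk hA hξ hn0 hw0
    have hmain := SpinLattice.transportationCost_of_le hk hd hA hξ hC hball hρ hσ hcor hw0 hn hwn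
    refine ⟨fun h => hmain ?_, ?_⟩
    · rw [← SpinLattice.costRadius_rpow hk hd hA hξ hn0 hw0] at h
      exact (Real.rpow_le_rpow_iff hr₀.le hr.le (by linarith)).1 h
    · rcases le_or_gt r₀ (SpinLattice.costRadius k d A ξ n w) with h | h
      · refine le_trans ?_ (hmain h)
        rw [EReal.coe_le_coe_iff]
        exact sub_le_sub_left (le_max_left _ _) _
      · refine le_trans ?_ hS
        have h1 := SpinLattice.rpow_mul_costF_le hk hd hA hξ hn0 hw0
        have h2 : SpinLattice.costRadius k d A ξ n w / (k * ξ) ≤ r₀ / (k * ξ) := by gcongr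
        have h3 : n ^ (1 / (2 * d + 1)) * SpinLattice.costF k d A ξ w
            - max (Real.log (C + 1)) (r₀ / (k * ξ)) ≤ 0 := by
          linarith [le_max_right (Real.log (C + 1)) (r₀ / (k * ξ))]
        exact_mod_cast h3
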